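/- Let $\mathbb{D}=\{|z|<1\}\subset\mathbb{C}$, let $z^*$ denote the complex conjugate of $z\in\mathbb{C}$, and let $\mathbb{B}=\{z_1+jz_2: z_1,z_2\in\mathbb{C}\}$, $j^2=-1$, be the commutative algebra of bicomplex numbers. Put $p^\pm=\frac12(1\pm ji)$; every $w=z_1+jz_2\in\mathbb{B}$ is uniquely $w=p^+w^++p^-w^-$ with $w^\pm=z_1\mp i z_2\in\mathbb{C}$, and $\|w\|_{\mathbb{B}}=\sqrt{(|w^+|^2+|w^-|^2)/2}$. Let $\bar\partial=\frac12\left(\frac{\partial}{\partial x}+j\frac{\partial}{\partial y}\right)$ and $\frac{\partial}{\partial z^*}=\frac12\left(\frac{\partial}{\partial x}+i\frac{\partial}{\partial y}\right)$, in the weak sense, and $$T_{\mathbb{D}}[f](z)=-\frac1\pi\iint_{\mathbb{D}}\frac{f(\zeta)}{\zeta-z}\,d\xi\,d\eta,\qquad \zeta=\xi+i\eta .$$ **Theorem.** Let $n$ be a positive integer, $2<q<\infty$, $A\in W^{n-1,q}(\mathbb{D},\mathbb{B})$, and $\gamma_k\in C(\partial\mathbb{D},\mathbb{B})$ for $0\le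 k\le n-1$. Boundary conditions mean that the function in question is continuous in $\mathbb{D}$ and tends to the prescribed value at every point of $\partial\mathbb{D}$. Define $$\varphi_+(z)=\sum_{k=0}^{n-1}\frac{(-1)^k}{2\pi i}\int_{|\zeta|=1}\frac{(\gamma_k^+)^*(\zeta)e^{-T_{\mathbb{D}}[(A^+)^*](\zeta)}}{k!}\,\frac{[(\zeta-z)^*]^k}{\zeta-z}\,d\zeta,$$ $$\varphi_-(z)=\sum_{k=0}^{n-1}\frac{(-1)^k}{2\pi i}\int_{|\zeta|=1}\frac{\gamma_k^-(\zeta)e^{-T_{\mathbb{D}}[A^-](\zeta)}}{k!}\,\frac{[(\zeta-z)^*]^k}{\zeta-z}\,d\zeta .$$ For a function $w=p^+w^++p^-w^-:\mathbb{D}\to\mathbb{B}$ the following three statements are equivalent: 1. $w$ solves the bicomplex Dirichlet problem $(\bar\partial-A)^nw=0$ in $\mathbb{D}$, $(\bar\partial-A)^kw=\gamma_k$ on $\partial\mathbb{D}$ for $0\le k\le n-1$. 2. $(w^+)^*$ and $w^-$ solve, respectively, the complex Dirichlet problems $$\left(\tfrac{\partial}{\partial z^*}-(A^+)^*\right)^n(w^+)^*=0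 \text{ in }\mathbb{D},\quad \left(\tfrac{\partial}{\partial z^*}-(A^+)^*\right)^k(w^+)^*=(\gamma_k^+)^* \text{ on }\partial\mathbb{D},\quad 0\le k\le n-1,$$ $$\left(\tfrac{\partial}{\partial z^*}-A^-\right)^nw^-=0 \text{ in }\mathbb{D},\quad \left(\tfrac{\partial}{\partial z^*}-A^-\right)^kw^-=\gamma_k^- \text{ on }\partial\mathbb{D},\quad 0\le k\le n-1.$$ 3. For all $|z|<1$ and $0\le k\le n-1$, $$\sum_{\lambda=k}^{n-1}\frac{z^*}{2\pi i}\int_{|\zeta|=1}(-1)^{\lambda-k}\frac{(\gamma_\lambda^+)^*(\zeta)e^{-T_{\mathbb{D}}[(A^+)^*](\zeta)}}{1-z^*\zeta}\,\frac{[(\zeta-z)^*]^{\lambda-k}}{(\lambda-k)!}\,d\zeta=0,$$ $$\sum_{\lambda=k}^{n-1}\frac{z^*}{2\pi i}\int_{|\zeta|=1}(-1)^{\lambda-k}\frac{\gamma_\lambda^-(\zeta)e^{-T_{\mathbb{D}}[A^-](\zeta)}}{1-z^*\zeta}\,\frac{[(\zeta-z)^*]^{\lambda-k}}{(\lambda-k)!}\,d\zeta=0,$$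 and $w=p^+\left(e^{T_{\mathbb{D}}[(A^+)^*]}\varphi_+\right)^*+p^-e^{T_{\mathbb{D}}[A^-]}\varphi_-$ in $\mathbb{D}$. Moreover, the following are equivalent: the bicomplex problem is solvable; the two complex problems are both solvable; the integral conditions displayed in 3 hold. Thus, when a solution $w$ exists, it is unique and given by the formula in 3. -/

import Mathlib

open MeasureTheory Set Filter Topology
open scoped ComplexConjugate ContDiff

noncomputable section

/-- The bicomplex numbers `z₁ + j z₂` with `z₁, z₂ : ℂ` and `j ^ 2 = -1`: here `re` is the scalar
part `z₁` and `im` is the vector part `z₂`. -/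
abbrev Bicomplex : Type := QuadraticAlgebra ℂ (-1) 0

namespace Bicomplex

theorem mk_mul_mk (z₁ z₂ w₁ w₂ : ℂ) :
    (⟨z₁, z₂⟩ * ⟨w₁, w₂⟩ : Bicomplex) = ⟨z₁ * w₁ - z₂ * w₂, z₁ * w₂ + z₂ * w₁⟩ := by
  ext
  · simp only [QuadraticAlgebra.re_mul]; ring
  · simp only [QuadraticAlgebra.im_mul]; ring

theorem one_re : (1 : Bicomplex).re = 1 := rfl

theorem one_im : (1 : Bicomplex).im = 0 := rfl

/-- The bicomplex imaginary unit `j`. -/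
def j : Bicomplex := ⟨0, 1⟩

theorem j_mul_j : j * j = -1 := by
  rw [show j = ⟨0, 1⟩ from rfl, mk_mul_mk]
  ext <;> simp [one_re, one_im]

/-- The component `w⁺ = Sc w - i Vec w`. -/
def plus (w : Bicomplex) : ℂ := w.re - Complex.I * w.im

/-- The component `w⁻ = Sc w + i Vec w`. -/
def minus (w : Bicomplex) : ℂ := w.re + Complex.I * w.im

/-- The idempotent `p⁺ = (1 + j i) / 2`. -/
def pPlus : Bicomplex := (1 / 2 : ℂ) • (1 + Complex.I • j)

/-- The idempotent `p⁻ = (1 - j i) / 2`. -/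
def pMinus : Bicomplex := (1 / 2 : ℂ) • (1 - Complex.I • j)

theorem plus_smul_add_minus_smul (w : Bicomplex) :
    w = plus w • pPlus + minus w • pMinus := by
  ext
  · simp [plus, minus, pPlus, pMinus, j, one_re]; ring
  · simp [plus, minus, pPlus, pMinus, j, one_im]; ring_nf; simp

theorem plus_combination (a b : ℂ) : plus (a • pPlus + b • pMinus) = a := by
  simp [plus, pPlus, pMinus, j, one_re, one_im]
  linear_combination (-(a - b) / 2) * Complex.I_mul_I

theorem minus_combination (a b : ℂ) : minus (a • pPlus + b • pMinus) = b := by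
  simp [minus, pPlus, pMinus, j, one_re, one_im]
  linear_combination ((a - b) / 2) * Complex.I_mul_I

/-- The identification of the bicomplex numbers with `ℂ²`, as a real linear map. -/
def toProdL2 : Bicomplex →ₗ[ℝ] WithLp 2 (ℂ × ℂ) where
  toFun w := WithLp.toLp 2 (w.re, w.im)
  map_add' _ _ := rfl
  map_smul' _ _ := rfl

theorem toProdL2_injective : Function.Injective toProdL2 := by
  intro a b h
  have h' : (a.re, a.im) = (b.re, b.im) := congrArg WithLp.ofLp h
  exact QuadraticAlgebra.ext (congrArg Prod.fst h') (congrArg Prod.snd h')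

/-- The bicomplex numbers with the Euclidean norm of `ℂ²`; `Bicomplex.norm_eq` below expresses this
norm through the components `w⁺` and `w⁻`. -/
instance : NormedAddCommGroup Bicomplex :=
  NormedAddCommGroup.induced Bicomplex (WithLp 2 (ℂ × ℂ)) toProdL2 toProdL2_injective

instance : NormedSpace ℝ Bicomplex :=
  NormedSpace.induced ℝ Bicomplex (WithLp 2 (ℂ × ℂ)) toProdL2

theorem norm_eq (w : Bicomplex) :
    ‖w‖ = Real.sqrt ((‖plus w‖ ^ 2 + ‖minus w‖ ^ 2) / 2) := by
  have h : ‖w‖ = ‖WithLp.toLp 2 (w.re, w.im)‖ := rfl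
  rw [h, WithLp.prod_norm_eq_of_L2]
  congr 1
  have e := parallelogram_law_with_norm ℝ w.re (Complex.I * w.im)
  have hI : ‖Complex.I * w.im‖ = ‖w.im‖ := by simp
  rw [hI] at e
  change ‖w.re‖ ^ 2 + ‖w.im‖ ^ 2 = _
  simp only [plus, minus]
  linarith [e]

end Bicomplex

/-- The open unit disk of the complex plane. -/
def disk : Set ℂ := Metric.ball 0 1

/-- Real-valued smooth test functions with compact support in the open unit disk. -/
structure IsTestFunction (φ : ℂ → ℝ) : Prop where
  smooth : ContDiff ℝ ∞ φ
  compact : HasCompactSupport φ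
  support : tsupport φ ⊆ disk

section Weak

variable {E : Type} [NormedAddCommGroup E] [NormedSpace ℝ E]

/-- `g` is the weak derivative of `u` on the unit disk in the direction `v`
(`v = 1` gives `∂/∂x`, and `v = i` gives `∂/∂y`). -/
def HasWeakPartial (v : ℂ) (u g : ℂ → E) : Prop :=
  LocallyIntegrableOn u disk ∧ LocallyIntegrableOn g disk ∧
    ∀ φ : ℂ → ℝ, IsTestFunction φ →
      ∫ z in disk, (fderiv ℝ φ z v) • u z = - ∫ z in disk, φ z • g z

/-- `u` belongs to the Sobolev space `W^{m,p}` of the unit disk: `u` and its weak derivatives of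
order at most `m` are in `L^p`. -/
def MemSobolev (p : ENNReal) : ℕ → (ℂ → E) → Prop
  | 0, u => MemLp u p (volume.restrict disk)
  | m + 1, u => MemLp u p (volume.restrict disk) ∧
      ∃ g h : ℂ → E, HasWeakPartial 1 u g ∧ HasWeakPartial Complex.I u h ∧
        MemSobolev p m g ∧ MemSobolev p m h

variable [Mul E]

/-- `f = (1/2) (∂/∂x + ι ∂/∂y) u` on the unit disk in the weak sense. This is the operator
`∂/∂z*` when `E = ℂ` and `ι = i`, and the bicomplex operator `∂̄` when `E` is the algebra of
bicomplex numbers and `ι = j`. -/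
def HasWeakDbar (ι : E) (u f : ℂ → E) : Prop :=
  LocallyIntegrableOn u disk ∧ LocallyIntegrableOn f disk ∧
    ∀ φ : ℂ → ℝ, IsTestFunction φ →
      ∫ z in disk,
          (1 / 2 : ℝ) • ((fderiv ℝ φ z 1) • u z + (fderiv ℝ φ z Complex.I) • (ι * u z)) =
        - ∫ z in disk, φ z • f z

/-- `v = (∂̄ - A)^k w` on the unit disk, where `∂̄ = (1/2) (∂/∂x + ι ∂/∂y)` in the weak sense. -/
def IsVekuaIterate (ι : E) (A : ℂ → E) : ℕ → (ℂ → E) → (ℂ → E) → Prop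
  | 0, w, v => EqOn v w disk
  | k + 1, w, v => ∃ u : ℂ → E, IsVekuaIterate ι A k w u ∧
      HasWeakDbar ι u (fun z => A z * u z + v z)

/-- `v` is continuous in the unit disk and attains the values `g` on the unit circle. -/
def AttainsBoundaryValues (v g : ℂ → E) : Prop :=
  ContinuousOn v disk ∧ ∀ ζ ∈ Metric.sphere (0 : ℂ) 1, Tendsto v (𝓝[disk] ζ) (𝓝 (g ζ))

/-- `w` solves the Dirichlet problem `(∂̄ - A)^n w = 0` in the unit disk, `(∂̄ - A)^k w = γ k` on
the unit circle for `0 ≤ k ≤ n - 1`, where `∂̄ = (1/2) (∂/∂x + ι ∂/∂y)`. -/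
def SolvesDirichlet (ι : E) (n : ℕ) (A : ℂ → E) (γ : ℕ → ℂ → E) (w : ℂ → E) : Prop :=
  IsVekuaIterate ι A n w (fun _ => 0) ∧
    ∀ k < n, ∃ v : ℂ → E, IsVekuaIterate ι A k w v ∧ AttainsBoundaryValues v (γ k)

end Weak

/-- The Vekua-Cauchy-Pompeiu-Teodorescu operator `T` of the unit disk. -/
def vekuaT (f : ℂ → ℂ) (z : ℂ) : ℂ :=
  -(1 / (Real.pi : ℂ)) * ∫ ζ in disk, f ζ / (ζ - z)

/-- The Cauchy-type integral conditions for the coefficient `a` and the boundary data `g`. -/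
def CauchyConditions (n : ℕ) (a : ℂ → ℂ) (g : ℕ → ℂ → ℂ) : Prop :=
  ∀ z ∈ disk, ∀ k < n,
    ∑ l ∈ Finset.Ico k n,
      conj z / (2 * Real.pi * Complex.I) *
        (∮ ζ in C(0, 1), (-1) ^ (l - k) *
          (g l ζ * Complex.exp (-vekuaT a ζ) / (1 - conj z * ζ)) *
          (conj (ζ - z) ^ (l - k) / ((l - k).factorial : ℂ))) = 0

/-- The function `φ` of the solution formula for the coefficient `a` and the boundary data `g`. -/
def cauchyPhi (n : ℕ) (a : ℂ → ℂ) (g : ℕ → ℂ → ℂ) (z : ℂ) : ℂ :=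
  ∑ k ∈ Finset.range n,
    (-1) ^ k / (2 * Real.pi * Complex.I) *
      (∮ ζ in C(0, 1), g k ζ * Complex.exp (-vekuaT a ζ) / (k.factorial : ℂ) *
        (conj (ζ - z) ^ k / (ζ - z)))

/-- The component `w⁺` of a bicomplex function, conjugated: `(w⁺)*`. -/
def plusConj (w : ℂ → Bicomplex) (z : ℂ) : ℂ := conj (w z).plus

/-- The component `w⁻` of a bicomplex function. -/
def minusPart (w : ℂ → Bicomplex) (z : ℂ) : ℂ := (w z).minus

/-- The explicit solution `p⁺ (e^{T[(A⁺)*]} φ₊)* + p⁻ e^{T[A⁻]} φ₋`. -/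
def solutionFormula (n : ℕ) (A : ℂ → Bicomplex) (γ : ℕ → ℂ → Bicomplex) (z : ℂ) : Bicomplex :=
  conj (Complex.exp (vekuaT (plusConj A) z) *
      cauchyPhi n (plusConj A) (fun k => plusConj (γ k)) z) • Bicomplex.pPlus +
    (Complex.exp (vekuaT (minusPart A) z) *
      cauchyPhi n (minusPart A) (fun k => minusPart (γ k)) z) • Bicomplex.pMinus

end

/-! The map `w ↦ ((w⁺)*, w⁻)` is an isomorphism of real algebras from the bicomplex numbers onto `ℂ
× ℂ`, and it sends `j` to `(i, i)`: conjugating the first component is what turns its `-i` into `i`.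
Test functions are real, so the map passes through the weak formulation and splits the bicomplex
problem into two independent complex ones (`solvesDirichlet_iff_components`). Everything then rests
on the scalar theorem `solvesDirichlet_iff`.

For the scalar problem, `∂(T a)/∂z* = a`. Hence multiplication by `e^{-T a}` turns `∂/∂z* - a` into
`∂/∂z*`, and the functions `W k = e^{-T a} (∂/∂z* - a)^k f` form a chain `∂(W k)/∂z* = W (k+1)` with
`W n = 0` (`HasWeakDbar.exp_vekuaT_mul`). Let `N` be the nilpotent shift `(N x) k = x (k+1)`. The
vector `h = exp(-z* N) W` is annihilated by `∂/∂z*`, so it is holomorphic by Weyl's lemma, and `W =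
exp(z* N) h`. The boundary data transform by the same matrix, so the problem decouples into `n`
boundary value problems for holomorphic functions.

A holomorphic function with continuous boundary values `H` is the Cauchy integral of `H`, and the
Cauchy integral of `H` at the reflected points `1 / z*` vanishes. Conversely, the interior integral
minus the one outside is the Poisson integral of `H` (`cauchyInt_add_cauchyExt`, where the sign is
part of `cauchyExt`), so if the outer integral vanishes the Cauchy integral attains `H`. Finally
`exp(z* N) exp(-ζ* N) = exp(-(ζ - z)* N)` brings the kernels `(-1)^m [(ζ - z)*]^m / m!` into the
integral conditions and the formula for `φ`. -/

noncomputable section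

/-! ### Test functions and calculus of the weak operator `∂/∂z*` -/

/-- The classical operator `∂/∂z* = (1/2) (∂/∂x + i ∂/∂y)`. -/
def dbar (φ : ℂ → ℂ) (z : ℂ) : ℂ :=
  (1 / 2) * (fderiv ℝ φ z 1 + Complex.I * fderiv ℝ φ z Complex.I)

/-- Complex-valued smooth test functions with compact support in the open unit disk. -/
structure IsComplexTest (φ : ℂ → ℂ) : Prop where
  smooth : ContDiff ℝ ∞ φ
  compact : HasCompactSupport φ
  support : tsupport φ ⊆ disk

theorem isOpen_disk : IsOpen disk := Metric.isOpen_ball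

theorem measurableSet_disk : MeasurableSet disk := isOpen_disk.measurableSet

theorem dbar_mul {φ ψ : ℂ → ℂ} {z : ℂ} (hφ : DifferentiableAt ℝ φ z)
    (hψ : DifferentiableAt ℝ ψ z) :
    dbar (fun w => φ w * ψ w) z = dbar φ z * ψ z + φ z * dbar ψ z := by
  simp only [dbar, fderiv_fun_mul hφ hψ, add_apply,
    smul_apply, smul_eq_mul]
  ring

theorem continuous_dbar {φ : ℂ → ℂ} (hφ : ContDiff ℝ ∞ φ) : Continuous (dbar φ) := by
  have h : Continuous (fderiv ℝ φ) := hφ.continuous_fderiv (by simp)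
  unfold dbar
  fun_prop

theorem dbar_eq_zero_of_notMem_tsupport {φ : ℂ → ℂ} {z : ℂ} (hz : z ∉ tsupport φ) :
    dbar φ z = 0 := by
  have : fderiv ℝ φ z = 0 := by
    by_contra h
    exact hz (support_fderiv_subset ℝ h)
  simp [dbar, this]

theorem tsupport_dbar_subset (φ : ℂ → ℂ) : tsupport (dbar φ) ⊆ tsupport φ := by
  refine closure_minimal (fun z hz => ?_) (isClosed_tsupport φ)
  by_contra h
  exact hz (dbar_eq_zero_of_notMem_tsupport h)

theorem integrableOn_mul_of_tsupport_subset {φ u : ℂ → ℂ} (hφ : ContinuousOn φ disk)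
    (hc : HasCompactSupport φ) (hs : tsupport φ ⊆ disk) (hu : LocallyIntegrableOn u disk) :
    IntegrableOn (fun z => φ z * u z) disk := by
  have h1 : IntegrableOn (fun z => φ z * u z) (tsupport φ) :=
    (hu.integrableOn_compact_subset hs hc).continuousOn_mul (hφ.mono hs) hc
  refine h1.of_forall_sdiff_eq_zero measurableSet_disk fun z hz => ?_
  rw [image_eq_zero_of_notMem_tsupport hz.2, zero_mul]

theorem IsComplexTest.integrableOn_mul {φ u : ℂ → ℂ} (hφ : IsComplexTest φ)
    (hu : LocallyIntegrableOn u disk) : IntegrableOn (fun z => φ z * u z) disk :=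
  integrableOn_mul_of_tsupport_subset hφ.smooth.continuous.continuousOn hφ.compact hφ.support hu

theorem IsComplexTest.integrableOn_dbar_mul {φ u : ℂ → ℂ} (hφ : IsComplexTest φ)
    (hu : LocallyIntegrableOn u disk) : IntegrableOn (fun z => dbar φ z * u z) disk :=
  integrableOn_mul_of_tsupport_subset (continuous_dbar hφ.smooth).continuousOn
    (hφ.compact.of_isClosed_subset (isClosed_tsupport _) (tsupport_dbar_subset φ))
    ((tsupport_dbar_subset φ).trans hφ.support) hu

theorem IsTestFunction.ofReal {φ : ℂ → ℝ} (hφ : IsTestFunction φ) :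
    IsComplexTest (fun z => (φ z : ℂ)) where
  smooth := Complex.ofRealCLM.contDiff.comp hφ.smooth
  compact := hφ.compact.comp_left (g := fun x : ℝ => (x : ℂ)) (by simp)
  support := (tsupport_comp_subset (g := fun x : ℝ => (x : ℂ)) (by simp) φ).trans hφ.support

theorem dbar_ofReal {φ : ℂ → ℝ} {z : ℂ} (hφ : DifferentiableAt ℝ φ z) :
    dbar (fun w => (φ w : ℂ)) z
      = (1 / 2) * ((fderiv ℝ φ z 1 : ℂ) + Complex.I * (fderiv ℝ φ z Complex.I : ℂ)) := by
  have h : HasFDerivAt (fun w => (φ w : ℂ)) (Complex.ofRealCLM.comp (fderiv ℝ φ z)) z :=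
    Complex.ofRealCLM.hasFDerivAt.comp z hφ.hasFDerivAt
  simp [dbar, h.fderiv]

theorem IsComplexTest.reTest {φ : ℂ → ℂ} (hφ : IsComplexTest φ) :
    IsTestFunction (fun z => (φ z).re) where
  smooth := Complex.reCLM.contDiff.comp hφ.smooth
  compact := hφ.compact.comp_left (g := Complex.re) (by simp)
  support := (tsupport_comp_subset (g := Complex.re) (by simp) φ).trans hφ.support

theorem IsComplexTest.imTest {φ : ℂ → ℂ} (hφ : IsComplexTest φ) :
    IsTestFunction (fun z => (φ z).im) where
  smooth := Complex.imCLM.contDiff.comp hφ.smooth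
  compact := hφ.compact.comp_left (g := Complex.im) (by simp)
  support := (tsupport_comp_subset (g := Complex.im) (by simp) φ).trans hφ.support

theorem dbar_eq_re_add_im {φ : ℂ → ℂ} {z : ℂ} (hφ : DifferentiableAt ℝ φ z) :
    dbar φ z = dbar (fun w => ((φ w).re : ℂ)) z
      + Complex.I * dbar (fun w => ((φ w).im : ℂ)) z := by
  have h1 : HasFDerivAt (fun w => (φ w).re) (Complex.reCLM.comp (fderiv ℝ φ z)) z :=
    Complex.reCLM.hasFDerivAt.comp z hφ.hasFDerivAt
  have h2 : HasFDerivAt (fun w => (φ w).im) (Complex.imCLM.comp (fderiv ℝ φ z)) z :=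
    Complex.imCLM.hasFDerivAt.comp z hφ.hasFDerivAt
  rw [dbar_ofReal h1.differentiableAt, dbar_ofReal h2.differentiableAt, h1.fderiv, h2.fderiv, dbar]
  simp only [ContinuousLinearMap.comp_apply, Complex.reCLM_apply, Complex.imCLM_apply]
  conv_lhs => rw [← Complex.re_add_im (fderiv ℝ φ z 1),
    ← Complex.re_add_im (fderiv ℝ φ z Complex.I)]
  ring

/-- Both sides are complex linear in the test function, so testing its real and imaginary parts
suffices. Complex test functions are needed because the product rule tests against `φ * m` with a
complex factor `m`. -/
theorem hasWeakDbar_iff_complexTest {u f : ℂ → ℂ} :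
    HasWeakDbar Complex.I u f ↔ LocallyIntegrableOn u disk ∧ LocallyIntegrableOn f disk ∧
      ∀ φ : ℂ → ℂ, IsComplexTest φ →
        ∫ z in disk, dbar φ z * u z = - ∫ z in disk, φ z * f z := by
  have key : ∀ φ : ℂ → ℝ, IsTestFunction φ →
      ∫ z in disk, (1 / 2 : ℝ) • ((fderiv ℝ φ z 1) • u z
          + (fderiv ℝ φ z Complex.I) • (Complex.I * u z))
        = ∫ z in disk, dbar (fun w => (φ w : ℂ)) z * u z := by
    intro φ hφ
    congr 1 with z
    rw [dbar_ofReal ((hφ.smooth.differentiable (by simp)) z)]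
    simp only [Complex.real_smul]
    push_cast
    ring
  constructor
  · rintro ⟨hu, hf, h⟩
    refine ⟨hu, hf, fun φ hφ => ?_⟩
    have e1 := h _ hφ.reTest
    have e2 := h _ hφ.imTest
    rw [key _ hφ.reTest] at e1
    rw [key _ hφ.imTest] at e2
    simp only [Complex.real_smul] at e1 e2
    have i1 := hφ.reTest.ofReal.integrableOn_dbar_mul hu
    have i2 := hφ.imTest.ofReal.integrableOn_dbar_mul hu
    have i3 := hφ.reTest.ofReal.integrableOn_mul hf
    have i4 := hφ.imTest.ofReal.integrableOn_mul hf
    calc ∫ z in disk, dbar φ z * u z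
        = ∫ z in disk, (dbar (fun w => ((φ w).re : ℂ)) z * u z
            + Complex.I * (dbar (fun w => ((φ w).im : ℂ)) z * u z)) := by
          congr 1 with z
          rw [dbar_eq_re_add_im ((hφ.smooth.differentiable (by simp)) z)]
          ring
      _ = - ∫ z in disk, (((φ z).re : ℂ) * f z + Complex.I * (((φ z).im : ℂ) * f z)) := by
          rw [integral_add i1 (i2.const_mul _), integral_const_mul, e1, e2,
            integral_add i3 (i4.const_mul _), integral_const_mul]
          ring
      _ = - ∫ z in disk, φ z * f z := by
          congr 2 with z
          conv_rhs => rw [← Complex.re_add_im (φ z)]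
          ring
  · rintro ⟨hu, hf, h⟩
    refine ⟨hu, hf, fun φ hφ => ?_⟩
    rw [key φ hφ, h _ hφ.ofReal]
    simp only [Complex.real_smul]

theorem HasWeakDbar.mul_smooth {u f m : ℂ → ℂ} (h : HasWeakDbar Complex.I u f)
    (hm : ContDiff ℝ ∞ m) :
    HasWeakDbar Complex.I (fun z => m z * u z) (fun z => m z * f z + dbar m z * u z) := by
  rw [hasWeakDbar_iff_complexTest] at h ⊢
  obtain ⟨hu, hf, h⟩ := h
  have hlc : IsLocallyClosed disk := isOpen_disk.isLocallyClosed
  have c1 := hu.continuousOn_mul hm.continuous.continuousOn hlc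
  have c2 := hf.continuousOn_mul hm.continuous.continuousOn hlc
  have c3 := hu.continuousOn_mul (continuous_dbar hm).continuousOn hlc
  refine ⟨c1, c2.add c3, fun φ hφ => ?_⟩
  have hφm : IsComplexTest (fun z => φ z * m z) :=
    ⟨hφ.smooth.mul hm, hφ.compact.mul_right, (tsupport_mul_subset_left).trans hφ.support⟩
  have e := h _ hφm
  have e1 : ∀ z, dbar (fun w => φ w * m w) z * u z
      = dbar φ z * (m z * u z) + φ z * (dbar m z * u z) := fun z => by
    rw [dbar_mul ((hφ.smooth.differentiable (by simp)) z) ((hm.differentiable (by simp)) z)]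
    ring
  simp_rw [e1] at e
  rw [integral_add (hφ.integrableOn_dbar_mul c1) (hφ.integrableOn_mul c3)] at e
  have e2 : ∀ z, φ z * (m z * f z + dbar m z * u z)
      = φ z * (m z * f z) + φ z * (dbar m z * u z) := fun z => by ring
  simp_rw [e2]
  rw [integral_add (hφ.integrableOn_mul c2) (hφ.integrableOn_mul c3)]
  simp_rw [mul_assoc] at e
  linear_combination e

theorem hasWeakDbar_zero : HasWeakDbar Complex.I (fun _ => (0 : ℂ)) (fun _ => 0) := by
  refine ⟨locallyIntegrableOn_zero, locallyIntegrableOn_zero, fun φ _ => by simp⟩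

theorem HasWeakDbar.add {u f u' f' : ℂ → ℂ} (h : HasWeakDbar Complex.I u f)
    (h' : HasWeakDbar Complex.I u' f') :
    HasWeakDbar Complex.I (fun z => u z + u' z) (fun z => f z + f' z) := by
  rw [hasWeakDbar_iff_complexTest] at h h' ⊢
  refine ⟨h.1.add h'.1, h.2.1.add h'.2.1, fun φ hφ => ?_⟩
  simp_rw [mul_add]
  rw [integral_add (hφ.integrableOn_dbar_mul h.1) (hφ.integrableOn_dbar_mul h'.1),
    integral_add (hφ.integrableOn_mul h.2.1) (hφ.integrableOn_mul h'.2.1), h.2.2 φ hφ, h'.2.2 φ hφ]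
  ring

theorem hasWeakDbar_sum {ι : Type*} (s : Finset ι) {u f : ι → ℂ → ℂ}
    (h : ∀ i ∈ s, HasWeakDbar Complex.I (u i) (f i)) :
    HasWeakDbar Complex.I (fun z => ∑ i ∈ s, u i z) (fun z => ∑ i ∈ s, f i z) := by
  classical
  induction s using Finset.induction_on with
  | empty => simpa using hasWeakDbar_zero
  | insert i s hi ih =>
    simp_rw [Finset.sum_insert hi]
    exact (h i (Finset.mem_insert_self i s)).add
      (ih fun j hj => h j (Finset.mem_insert_of_mem hj))

theorem LocallyIntegrableOn.congr_ae_disk {u u' : ℂ → ℂ} (hu : LocallyIntegrableOn u disk)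
    (h : u =ᵐ[volume.restrict disk] u') : LocallyIntegrableOn u' disk := by
  rw [locallyIntegrableOn_iff isOpen_disk.isLocallyClosed] at hu ⊢
  intro K hK hKc
  exact (hu K hK hKc).congr (ae_restrict_of_ae_restrict_of_subset hK h)

theorem HasWeakDbar.congr_ae {u f u' f' : ℂ → ℂ} (h : HasWeakDbar Complex.I u f)
    (hu : u =ᵐ[volume.restrict disk] u') (hf : f =ᵐ[volume.restrict disk] f') :
    HasWeakDbar Complex.I u' f' := by
  rw [hasWeakDbar_iff_complexTest] at h ⊢
  refine ⟨LocallyIntegrableOn.congr_ae_disk h.1 hu, LocallyIntegrableOn.congr_ae_disk h.2.1 hf,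
    fun φ hφ => ?_⟩
  rw [integral_congr_ae (g := fun z => dbar φ z * u z), h.2.2 φ hφ,
    integral_congr_ae (g := fun z => φ z * f' z)]
  · filter_upwards [hf] with z hz using by rw [hz]
  · filter_upwards [hu] with z hz using by rw [hz]

/-- The difference of two candidates is orthogonal to every test function, so the fundamental lemma
of the calculus of variations applies. -/
theorem HasWeakDbar.ae_unique {u f u' f' : ℂ → ℂ} (h : HasWeakDbar Complex.I u f)
    (h' : HasWeakDbar Complex.I u' f') (hu : u =ᵐ[volume.restrict disk] u') :
    f =ᵐ[volume.restrict disk] f' := by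
  have h2 : HasWeakDbar Complex.I u f' := h'.congr_ae hu.symm EventuallyEq.rfl
  rw [hasWeakDbar_iff_complexTest] at h h2
  have hd : LocallyIntegrableOn (fun z => f z - f' z) disk := h.2.1.sub h2.2.1
  have := isOpen_disk.ae_eq_zero_of_integral_contDiff_smul_eq_zero hd fun g hg hgc hgs => by
    have hφ : IsComplexTest (fun z => (g z : ℂ)) := IsTestFunction.ofReal ⟨hg, hgc, hgs⟩
    have e := (h.2.2 _ hφ).symm.trans (h2.2.2 _ hφ)
    rw [neg_inj] at e
    simp only [Complex.real_smul]
    rw [← setIntegral_eq_integral_of_forall_compl_eq_zero (s := disk)]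
    · simp_rw [mul_sub]
      rw [integral_sub (hφ.integrableOn_mul h.2.1) (hφ.integrableOn_mul h2.2.1), e, sub_self]
    · intro z hz
      rw [image_eq_zero_of_notMem_tsupport (fun hz' => hz (hgs hz')), Complex.ofReal_zero, zero_mul]
  rw [EventuallyEq, ae_restrict_iff' measurableSet_disk]
  filter_upwards [this] with z hz hzd using sub_eq_zero.1 (hz hzd)

/-! ### Holomorphic functions as weak solutions, and Weyl's lemma -/

/-- Integration by parts against the constant function `1`, in each coordinate direction. -/
theorem integral_dbar_eq_zero {ψ : ℂ → ℂ} (h : ContDiff ℝ ∞ ψ) (hc : HasCompactSupport ψ) :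
    ∫ z, dbar ψ z = 0 := by
  have hcont : Continuous (fderiv ℝ ψ) := h.continuous_fderiv (by simp)
  have hi : ∀ v : ℂ, Integrable (fun z => fderiv ℝ ψ z v) := fun v =>
    (hcont.clm_apply continuous_const).integrable_of_hasCompactSupport
      ((hc.fderiv ℝ).comp_left (g := fun L : ℂ →L[ℝ] ℂ => L v) (by simp))
  have h0 : ∀ v : ℂ, ∫ z, fderiv ℝ ψ z v = 0 := fun v => by
    have := integral_mul_fderiv_eq_neg_fderiv_mul_of_integrable (μ := volume) (𝕜 := ℂ)
      (f := fun _ : ℂ => (1 : ℂ)) (g := ψ) (v := v) (by simp) (by simpa using hi v)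
      (by simpa using h.continuous.integrable_of_hasCompactSupport hc)
      (fun _ _ => differentiableAt_const _) (fun x _ => (h.differentiable (by simp)) x)
    simpa using this
  unfold dbar
  rw [integral_const_mul, integral_add (hi 1) ((hi Complex.I).const_mul _), integral_const_mul,
    h0, h0]
  simp

theorem dbar_eq_zero_of_differentiableAt {h : ℂ → ℂ} {z : ℂ} (hz : DifferentiableAt ℂ h z) :
    dbar h z = 0 := by
  rw [dbar, hz.fderiv_restrictScalars ℝ]
  have : (fderiv ℂ h z) Complex.I = Complex.I * (fderiv ℂ h z) 1 := by
    rw [← smul_eq_mul, ← map_smul]; simp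
  simp only [ContinuousLinearMap.coe_restrictScalars', this]
  linear_combination (1 / 2) * (fderiv ℂ h z) 1 * Complex.I_mul_I

/-- The product `φ h` is smooth with compact support on the whole plane, whatever `h` does off the
disk, and on the disk its `∂/∂z*` derivative is `dbar φ * h`; the integral of that derivative is
zero. -/
theorem hasWeakDbar_of_differentiableOn {h : ℂ → ℂ} (hh : DifferentiableOn ℂ h disk) :
    HasWeakDbar Complex.I h (fun _ => 0) := by
  rw [hasWeakDbar_iff_complexTest]
  refine ⟨hh.continuousOn.locallyIntegrableOn measurableSet_disk, locallyIntegrableOn_zero,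
    fun φ hφ => ?_⟩
  have hψ : ContDiff ℝ ∞ (fun z => φ z * h z) := by
    refine contDiff_iff_contDiffAt.2 fun z => ?_
    by_cases hz : z ∈ tsupport φ
    swap
    · refine (contDiffAt_const (c := (0 : ℂ))).congr_of_eventuallyEq ?_
      filter_upwards [(isClosed_tsupport φ).isOpen_compl.mem_nhds hz] with w hw
      rw [image_eq_zero_of_notMem_tsupport hw, zero_mul]
    have hzd : z ∈ disk := hφ.support hz
    refine hφ.smooth.contDiffAt.mul ?_
    have : ContDiffAt ℂ ∞ h z := (hh.contDiffOn isOpen_disk).contDiffAt (isOpen_disk.mem_nhds hzd)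
    exact this.restrict_scalars ℝ
  have e := integral_dbar_eq_zero hψ (hφ.compact.mul_right)
  rw [← setIntegral_eq_integral_of_forall_compl_eq_zero (s := disk)] at e
  · simp only [mul_zero, integral_zero, neg_zero]
    rw [← e]
    refine setIntegral_congr_fun measurableSet_disk fun z hz => ?_
    have hd : DifferentiableAt ℂ h z := hh.differentiableAt (isOpen_disk.mem_nhds hz)
    simp only [dbar_mul ((hφ.smooth.differentiable (by simp)) z) (hd.restrictScalars ℝ),
      dbar_eq_zero_of_differentiableAt hd, mul_zero, add_zero]
  · intro z hz
    exact dbar_eq_zero_of_notMem_tsupport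
      fun hz' => hz (hφ.support (tsupport_mul_subset_left hz'))

theorem contDiff_integral_mul_sub {f g : ℂ → ℂ} (hf : ContDiff ℝ ∞ f) (hc : HasCompactSupport f)
    (hg : LocallyIntegrable g) : ContDiff ℝ ∞ (fun z => ∫ t, g t * f (z - t)) :=
  hc.contDiff_convolution_right (ContinuousLinearMap.mul ℝ ℂ) hg hf

theorem dbar_integral_mul_sub {f g : ℂ → ℂ} (hf : ContDiff ℝ ∞ f) (hc : HasCompactSupport f)
    (hg : LocallyIntegrable g) (z : ℂ) :
    dbar (fun z => ∫ t, g t * f (z - t)) z = ∫ t, g t * dbar f (z - t) := by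
  have h1 := hc.hasFDerivAt_convolution_right (ContinuousLinearMap.mul ℝ ℂ) hg
    (hf.of_le (by simp)) z
  have hcont : Continuous (fderiv ℝ f) := hf.continuous_fderiv (by simp)
  have hex : ConvolutionExistsAt g (fderiv ℝ f) z
      ((ContinuousLinearMap.mul ℝ ℂ).precompR ℂ) volume :=
    (hc.fderiv ℝ).convolutionExists_right _ hg hcont z
  have h2 : ∀ v, fderiv ℝ (fun z => ∫ t, g t * f (z - t)) z v
      = ∫ t, g t * fderiv ℝ f (z - t) v := fun v => by
    have e : fderiv ℝ (fun z => ∫ t, g t * f (z - t)) z = _ := h1.fderiv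
    rw [e, convolution, ContinuousLinearMap.integral_apply hex]
    rfl
  have hi : ∀ v, Integrable (fun t => g t * fderiv ℝ f (z - t) v) := fun v =>
    hex.apply_continuousLinearMap v
  rw [dbar, h2, h2, ← integral_const_mul, ← integral_add (hi 1) ((hi _).const_mul _),
    ← integral_const_mul]
  congr 1 with t
  rw [dbar]
  ring

theorem dbar_comp_const_sub {f : ℂ → ℂ} (hf : Differentiable ℝ f) (z t : ℂ) :
    dbar (fun t => f (z - t)) t = - dbar f (z - t) := by
  have h : HasFDerivAt (fun t => f (z - t))
      ((fderiv ℝ f (z - t)).comp (-(ContinuousLinearMap.id ℝ ℂ))) t := by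
    have := ((hf (z - t)).hasFDerivAt).comp t ((hasFDerivAt_id t).const_sub z)
    exact this
  rw [dbar, h.fderiv, dbar]
  simp
  ring

theorem differentiableAt_of_dbar_eq_zero {h : ℂ → ℂ} {z : ℂ} (hd : DifferentiableAt ℝ h z)
    (hz : dbar h z = 0) : DifferentiableAt ℂ h z := by
  rw [differentiableAt_complex_iff_differentiableAt_real]
  refine ⟨hd, ?_⟩
  rw [dbar] at hz
  have : fderiv ℝ h z 1 + Complex.I * fderiv ℝ h z Complex.I = 0 := by simpa using hz
  rw [smul_eq_mul]
  linear_combination -Complex.I * this + (fderiv ℝ h z) Complex.I * Complex.I_mul_I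

/-- Weyl's lemma for the operator `∂/∂z*`: continuous weak solutions are holomorphic. -/
theorem HasWeakDbar.differentiableOn {u : ℂ → ℂ} (h : HasWeakDbar Complex.I u (fun _ => 0))
    (hu : ContinuousOn u disk) : DifferentiableOn ℂ u disk := by
  rw [hasWeakDbar_iff_complexTest] at h
  obtain ⟨-, -, h⟩ := h
  simp only [mul_zero, integral_zero, neg_zero] at h
  suffices H : ∀ r < 1, DifferentiableOn ℂ u (Metric.ball 0 r) by
    intro z hz
    have hz1 : ‖z‖ < 1 := by simpa [disk] using hz
    obtain ⟨r, hr, hr1⟩ := exists_between hz1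
    exact ((H r hr1).differentiableAt (Metric.isOpen_ball.mem_nhds
      (by simpa using hr))).differentiableWithinAt
  intro r hr
  obtain ⟨R, hrR, hR1⟩ := exists_between hr
  have hKd : Metric.closedBall (0 : ℂ) R ⊆ disk := Metric.closedBall_subset_ball hR1
  have hK : IsCompact (Metric.closedBall (0 : ℂ) R) := isCompact_closedBall _ _
  have huK := hu.mono hKd
  have huc := hK.uniformContinuousOn_of_continuous huK
  -- Cutting `u` off at radius `R < 1` makes it integrable on the plane. On the ball of radius `r <
  -- R`, mollifiers of radius below `R - r` do not see the cut.
  set v := (Metric.closedBall (0 : ℂ) R).indicator u with hv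
  have hvi : Integrable v := (integrable_indicator_iff hK.measurableSet).2
    (huK.integrableOn_compact hK)
  let b : ℕ → ContDiffBump (0 : ℂ) := fun n =>
    ⟨1 / ((n : ℝ) + 1) / 2, 1 / ((n : ℝ) + 1), by positivity, half_lt_self (by positivity)⟩
  have hb : ∀ n, (b n).rOut = 1 / ((n : ℝ) + 1) := fun n => rfl
  let ρ : ℕ → ℂ → ℂ := fun n z => (((b n).normed volume z : ℝ) : ℂ)
  have hρs : ∀ n, ContDiff ℝ ∞ (ρ n) := fun n =>
    Complex.ofRealCLM.contDiff.comp (b n).contDiff_normed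
  have hρc : ∀ n, HasCompactSupport (ρ n) := fun n =>
    ((b n).hasCompactSupport_normed).comp_left (g := fun x : ℝ => (x : ℂ)) (by simp)
  have hρt : ∀ n, tsupport (ρ n) ⊆ Metric.closedBall 0 (1 / ((n : ℝ) + 1)) := fun n => by
    refine (tsupport_comp_subset (g := fun x : ℝ => (x : ℂ)) (by simp) _).trans ?_
    rw [(b n).tsupport_normed_eq, hb]
  let F : ℕ → ℂ → ℂ := fun n z => ∫ t, v t * ρ n (z - t)
  have hsmall : ∀ δ > 0, ∀ᶠ n : ℕ in atTop, 1 / ((n : ℝ) + 1) < δ := fun δ hδ =>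
    (tendsto_one_div_add_atTop_nhds_zero_nat (𝕜 := ℝ)).eventually (gt_mem_nhds hδ)
  have hF : ∀ᶠ n in atTop, DifferentiableOn ℂ (F n) (Metric.ball 0 r) := by
    filter_upwards [hsmall (R - r) (sub_pos.2 hrR)] with n hn z hz
    refine (differentiableAt_of_dbar_eq_zero
      (((contDiff_integral_mul_sub (hρs n) (hρc n) hvi.locallyIntegrable).differentiable
        (by simp)) z) ?_).differentiableWithinAt
    rw [dbar_integral_mul_sub (hρs n) (hρc n) hvi.locallyIntegrable z]
    have hsub : tsupport (fun t => ρ n (z - t)) ⊆ Metric.closedBall z (1 / ((n : ℝ) + 1)) := by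
      refine closure_minimal (fun t ht => ?_) Metric.isClosed_closedBall
      have := hρt n (subset_tsupport _ ht)
      rw [Metric.mem_closedBall, dist_zero_right] at this
      rwa [Metric.mem_closedBall, dist_comm, dist_eq_norm]
    have hsubR : tsupport (fun t => ρ n (z - t)) ⊆ Metric.closedBall 0 R := by
      refine hsub.trans (Metric.closedBall_subset_closedBall' ?_)
      have : dist z 0 < r := hz
      linarith
    -- The reflected mollifier is a test function in `t`, and the weak equation tested against it
    -- says that the mollification of `u` has zero `∂/∂z*` derivative at `z`.
    have hφ : IsComplexTest (fun t => ρ n (z - t)) :=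
      ⟨(hρs n).comp (contDiff_const.sub contDiff_id),
        HasCompactSupport.of_support_subset_isCompact hK ((subset_tsupport _).trans hsubR),
        hsubR.trans hKd⟩
    have e := h _ hφ
    rw [setIntegral_eq_integral_of_forall_compl_eq_zero] at e
    · rw [← neg_eq_zero, ← integral_neg, ← e]
      congr 1 with t
      rw [dbar_comp_const_sub ((hρs n).differentiable (by simp))]
      by_cases ht : t ∈ Metric.closedBall (0 : ℂ) R
      · rw [hv, indicator_of_mem ht]; ring
      · have h0 := dbar_eq_zero_of_notMem_tsupport (fun h' => ht (hsubR h'))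
        rw [dbar_comp_const_sub ((hρs n).differentiable (by simp)), neg_eq_zero] at h0
        rw [h0]; simp
    · intro t ht
      rw [dbar_eq_zero_of_notMem_tsupport (fun h' => ht (hKd (hsubR h'))), zero_mul]
  -- The holomorphic mollifications converge to `u` uniformly on the smaller ball, since `u` is
  -- uniformly continuous on the larger one.
  refine TendstoLocallyUniformlyOn.differentiableOn (φ := atTop) (F := F) ?_ hF Metric.isOpen_ball
  refine TendstoUniformlyOn.tendstoLocallyUniformlyOn ?_
  rw [Metric.tendstoUniformlyOn_iff]
  intro ε hε
  rw [Metric.uniformContinuousOn_iff] at huc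
  obtain ⟨δ, hδ, hδu⟩ := huc (ε / 2) (half_pos hε)
  filter_upwards [hsmall (R - r) (sub_pos.2 hrR), hsmall δ hδ] with n hn hn' z hz
  have hzr : dist z 0 < r := hz
  have hzK : z ∈ Metric.closedBall (0 : ℂ) R := (hzr.trans hrR).le
  have e : F n z = convolution ((b n).normed volume) v (ContinuousLinearMap.lsmul ℝ ℝ) volume z := by
    rw [convolution_lsmul_swap]
    change ∫ t, _ = ∫ t, _
    congr 1 with t
    simp only [ρ, Complex.real_smul]
    ring
  have := (b n).dist_normed_convolution_le (μ := volume) (g := v) (x₀ := z) (ε := ε / 2)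
    hvi.aestronglyMeasurable fun x hx => by
      rw [hb] at hx
      have hxK : x ∈ Metric.closedBall (0 : ℂ) R := by
        rw [Metric.mem_closedBall]
        have := dist_triangle x z 0
        have hx' : dist x z < _ := hx
        linarith
      rw [hv, indicator_of_mem hxK, indicator_of_mem hzK]
      exact (hδu x hxK z hzK (lt_trans hx hn')).le
  rw [← e, dist_comm, hv, indicator_of_mem hzK] at this
  linarith

/-! ### The kernel `1 / (ζ - z)` and bounds for `T` on `L^q`, `q > 2` -/

theorem locallyIntegrable_inv : LocallyIntegrable (fun z : ℂ => z⁻¹) := by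
  rw [locallyIntegrable_iff]
  intro K hK
  obtain ⟨r, hr⟩ := hK.isBounded.subset_ball (0 : ℂ)
  refine IntegrableOn.mono_set ?_ hr
  have h : IntegrableOn (fun x : ℂ => ‖x‖⁻¹) (Metric.ball 0 r) := by
    rw [integrableOn_fun_norm_addHaar volume (f := fun y => y⁻¹)]
    have : IntegrableOn (fun _ : ℝ => (1 : ℝ)) (Ioo 0 r) := by simp
    refine this.congr_fun (fun y hy => ?_) measurableSet_Ioo
    simp [Complex.finrank_real_complex, hy.1.ne']
  refine (integrable_norm_iff (by fun_prop)).1 ?_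
  simp only [norm_inv]
  exact h

/-- Where `‖ζ - z‖ < 1`, translation bounds the integral by that of `‖s‖^(-p)` over the unit ball,
finite for `p < 2` because the area element is `r dr dθ`. Elsewhere the integrand is at most `1`.
Neither bound depends on `z`. -/
theorem exists_lintegral_kernel_le {p : ℝ} (hp0 : 0 < p) (hp : p < 2) :
    ∃ K : ENNReal, K ≠ ⊤ ∧ ∀ z : ℂ, ∫⁻ ζ in disk, ‖(ζ - z)⁻¹‖ₑ ^ p ≤ K := by
  set g : ℂ → ENNReal := (Metric.ball (0 : ℂ) 1).indicator fun s => ‖s⁻¹‖ₑ ^ p with hg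
  have h : IntegrableOn (fun x : ℂ => ‖x‖ ^ (-p)) (Metric.ball 0 1) := by
    rw [integrableOn_fun_norm_addHaar volume (f := fun y => y ^ (-p))]
    have : IntegrableOn (fun y : ℝ => y ^ (1 - p)) (Ioo 0 1) :=
      (intervalIntegral.integrableOn_Ioo_rpow_iff one_pos).2 (by linarith)
    refine this.congr_fun (fun y hy => ?_) measurableSet_Ioo
    simp [Complex.finrank_real_complex, sub_eq_add_neg, Real.rpow_add hy.1]
  have hfin : ∫⁻ s, g s ≠ ⊤ := by
    rw [hg, lintegral_indicator Metric.isOpen_ball.measurableSet]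
    have h2 := h.hasFiniteIntegral
    rw [hasFiniteIntegral_iff_enorm] at h2
    refine ne_top_of_le_ne_top h2.ne (lintegral_mono_ae ?_)
    have : ∀ᵐ x : ℂ ∂(volume.restrict (Metric.ball 0 1)), x ≠ 0 :=
      ae_restrict_of_ae (by simp [ae_iff])
    filter_upwards [this] with x hx
    rw [Real.rpow_neg (norm_nonneg x), ← Real.inv_rpow (norm_nonneg x), ← norm_inv,
      Real.enorm_rpow_of_nonneg (norm_nonneg _) hp0.le, enorm_norm]
  refine ⟨(∫⁻ s, g s) + volume disk, ?_, fun z => ?_⟩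
  · exact ENNReal.add_ne_top.2 ⟨hfin, (measure_ball_lt_top (x := (0 : ℂ)) (r := 1)).ne⟩
  calc ∫⁻ ζ in disk, ‖(ζ - z)⁻¹‖ₑ ^ p ≤ ∫⁻ ζ in disk, (g (ζ - z) + 1) := by
        refine lintegral_mono fun ζ => ?_
        by_cases hζ : ζ - z ∈ Metric.ball (0 : ℂ) 1
        · simp only [hg, indicator_of_mem hζ]; exact le_self_add
        · refine le_trans ?_ le_add_self
          refine ENNReal.rpow_le_one ?_ hp0.le
          have h1 : 1 ≤ ‖ζ - z‖ := by simpa using hζ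
          rw [← ofReal_norm, norm_inv]
          exact ENNReal.ofReal_le_one.2 (inv_le_one_of_one_le₀ h1)
    _ = (∫⁻ ζ in disk, g (ζ - z)) + volume disk := by
        rw [lintegral_add_right _ measurable_const, setLIntegral_const, one_mul]
    _ ≤ (∫⁻ s, g s) + volume disk := by
        refine add_le_add_left ((setLIntegral_le_lintegral _ _).trans ?_) _
        rw [lintegral_sub_right_eq_self g z]

/-- Hölder's inequality: `q > 2` makes the conjugate exponent less than `2`, so the kernel is
uniformly in the dual space. -/
theorem exists_integral_kernel_le {q : ℝ} (hq : 2 < q) :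
    ∃ C : ℝ, 0 ≤ C ∧ ∀ f : ℂ → ℂ, MemLp f (ENNReal.ofReal q) (volume.restrict disk) → ∀ z : ℂ,
      IntegrableOn (fun ζ => f ζ / (ζ - z)) disk ∧
      ∫ ζ in disk, ‖f ζ / (ζ - z)‖
        ≤ C * (eLpNorm f (ENNReal.ofReal q) (volume.restrict disk)).toReal := by
  have hq1 : 1 < q := by linarith
  have hpq : q.HolderConjugate (Real.conjExponent q) := Real.HolderConjugate.conjExponent hq1
  have hp2 : Real.conjExponent q < 2 := by
    rw [Real.conjExponent, div_lt_iff₀ (by linarith)]; linarith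
  obtain ⟨K, hK, hle⟩ := exists_lintegral_kernel_le hpq.symm.pos hp2
  set p := Real.conjExponent q
  have hKp : K ^ (1 / p) ≠ ⊤ := ENNReal.rpow_ne_top_of_nonneg
    (by have := hpq.symm.pos; positivity) hK
  refine ⟨(K ^ (1 / p)).toReal, ENNReal.toReal_nonneg, fun f hf z => ?_⟩
  have hm : AEStronglyMeasurable (fun ζ => f ζ / (ζ - z)) (volume.restrict disk) := by
    have := hf.aestronglyMeasurable
    have h2 : AEStronglyMeasurable (fun ζ : ℂ => (ζ - z)⁻¹) (volume.restrict disk) := by fun_prop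
    exact this.mul h2
  have hb : ∫⁻ ζ in disk, ‖f ζ / (ζ - z)‖ₑ
      ≤ K ^ (1 / p) * eLpNorm f (ENNReal.ofReal q) (volume.restrict disk) := by
    calc ∫⁻ ζ in disk, ‖f ζ / (ζ - z)‖ₑ = ∫⁻ ζ in disk, ‖f ζ‖ₑ * ‖(ζ - z)⁻¹‖ₑ := by
          congr 1 with ζ; rw [div_eq_mul_inv, enorm_mul]
      _ ≤ (∫⁻ ζ in disk, ‖f ζ‖ₑ ^ q) ^ (1 / q) * (∫⁻ ζ in disk, ‖(ζ - z)⁻¹‖ₑ ^ p) ^ (1 / p) :=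
          ENNReal.lintegral_mul_le_Lp_mul_Lq _ hpq hf.aestronglyMeasurable.aemeasurable.enorm
            (by fun_prop)
      _ ≤ _ := by
          rw [mul_comm, eLpNorm_eq_lintegral_rpow_enorm_toReal (by simp; linarith) (by simp),
            ENNReal.toReal_ofReal (by linarith)]
          gcongr
          · have := hpq.symm.pos; positivity
          · exact hle z
  have hfin : K ^ (1 / p) * eLpNorm f (ENNReal.ofReal q) (volume.restrict disk) ≠ ⊤ :=
    ENNReal.mul_ne_top hKp hf.eLpNorm_ne_top
  refine ⟨⟨hm, lt_of_le_of_lt hb hfin.lt_top⟩, ?_⟩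
  rw [integral_norm_eq_lintegral_enorm hm, ← ENNReal.toReal_mul]
  exact ENNReal.toReal_mono hfin hb

theorem vekuaT_neg (f : ℂ → ℂ) (z : ℂ) : vekuaT (fun ζ => -f ζ) z = -vekuaT f z := by
  simp [vekuaT, neg_div, integral_neg]

theorem exists_norm_vekuaT_le {q : ℝ} (hq : 2 < q) :
    ∃ C : ℝ, 0 ≤ C ∧ (∀ f : ℂ → ℂ, MemLp f (ENNReal.ofReal q) (volume.restrict disk) →
        IntegrableOn f disk ∧ ∫ ζ in disk, ‖f ζ‖
          ≤ C * (eLpNorm f (ENNReal.ofReal q) (volume.restrict disk)).toReal) ∧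
      ∀ f g : ℂ → ℂ, MemLp f (ENNReal.ofReal q) (volume.restrict disk) →
        MemLp g (ENNReal.ofReal q) (volume.restrict disk) → ∀ z,
        ‖vekuaT f z - vekuaT g z‖
          ≤ C * (eLpNorm (f - g) (ENNReal.ofReal q) (volume.restrict disk)).toReal := by
  obtain ⟨C, hC, h⟩ := exists_integral_kernel_le hq
  have hfin : IsFiniteMeasure (volume.restrict disk) :=
    ⟨by rw [Measure.restrict_apply_univ]; exact measure_ball_lt_top⟩
  refine ⟨C, hC, fun f hf => ?_, fun f g hf hg z => ?_⟩
  · have hi : IntegrableOn f disk := hf.integrable (by simp; linarith)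
    -- On the disk `‖f ζ‖ ≤ ‖f ζ / ζ‖`, so the kernel bound at `z = 0` also controls the `L^1` norm.
    refine ⟨hi, le_trans ?_ (h f hf 0).2⟩
    refine integral_mono_ae hi.norm (h f hf 0).1.norm ?_
    have h0 : ∀ᵐ x : ℂ ∂(volume.restrict disk), x ≠ 0 := ae_restrict_of_ae (by simp [ae_iff])
    filter_upwards [ae_restrict_mem measurableSet_disk, h0] with ζ hζ hζ0
    have hζ1 : ‖ζ‖ ≤ 1 := by
      have : ‖ζ‖ < 1 := by simpa [disk] using hζ
      exact this.le
    rw [sub_zero, norm_div]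
    exact le_div_self (norm_nonneg _) (norm_pos_iff.2 hζ0) hζ1
  · have e : vekuaT f z - vekuaT g z
        = -(1 / (Real.pi : ℂ)) * ∫ ζ in disk, (f - g) ζ / (ζ - z) := by
      rw [vekuaT, vekuaT, ← mul_sub, ← integral_sub (h f hf z).1 (h g hg z).1]
      congr 2 with ζ
      simp [sub_div]
    rw [e, norm_mul]
    have hπ : ‖-(1 / (Real.pi : ℂ))‖ ≤ 1 := by
      rw [norm_neg, norm_div, norm_one, Complex.norm_real, Real.norm_of_nonneg Real.pi_pos.le]
      exact (div_le_one Real.pi_pos).2 (by linarith [Real.pi_gt_three])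
    calc _ ≤ 1 * ‖∫ ζ in disk, (f - g) ζ / (ζ - z)‖ := by gcongr
      _ ≤ ∫ ζ in disk, ‖(f - g) ζ / (ζ - z)‖ := by
        rw [one_mul]; exact norm_integral_le_integral_norm _
      _ ≤ _ := (h (f - g) (hf.sub hg) z).2

/-! ### The Cauchy–Pompeiu formula and the equation `∂(T f)/∂z* = f` -/

/-- The Cauchy–Pompeiu formula for smooth compactly supported functions. -/
theorem integral_dbar_div {F : ℂ → ℂ} (hF : ContDiff ℝ ∞ F) (hc : HasCompactSupport F) :
    ∫ s, dbar F s / s = -Real.pi * F 0 := by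
  have hd : Differentiable ℝ F := hF.differentiable (by simp)
  have hcont : Continuous (fderiv ℝ F) := hF.continuous_fderiv (by simp)
  obtain ⟨R, hR0, hR⟩ : ∃ R > 0, tsupport F ⊆ Metric.closedBall 0 R :=
    hc.isBounded.subset_closedBall_lt 0 0 |>.imp fun R h => ⟨h.1, h.2⟩
  let e : ℝ → ℂ := fun θ => Real.cos θ + Real.sin θ * Complex.I
  have hen : ∀ θ, ‖e θ‖ = 1 := fun θ => by
    simp only [e]; rw [Complex.ofReal_cos, Complex.ofReal_sin, ← Complex.exp_mul_I,
      Complex.norm_exp_ofReal_mul_I]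
  have hec : Continuous e := by fun_prop
  have hed : ∀ θ : ℝ, HasDerivAt e (Complex.I * e θ) θ := fun θ => by
    have h1 := (Real.hasDerivAt_cos θ).ofReal_comp
    have h2 := ((Real.hasDerivAt_sin θ).ofReal_comp).mul_const Complex.I
    convert! h1.add h2 using 1
    simp only [e]; push_cast
    linear_combination Complex.sin θ * Complex.I_mul_I
  -- In polar coordinates `D 1` is `∂F/∂r` and `D I` is `(1/r) ∂F/∂θ`. With the Jacobian `r`, the
  -- integrand `dbar F s / s` becomes `(D 1 + i D I) / 2`, without a singularity.
  let D : ℂ → ℝ × ℝ → ℂ := fun c p => fderiv ℝ F (p.1 * e p.2) (c * e p.2)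
  have hDc : ∀ c, Continuous (D c) := fun c => by
    have : Continuous fun p : ℝ × ℝ => fderiv ℝ F (p.1 * e p.2) := hcont.comp (by fun_prop)
    exact this.clm_apply (by fun_prop)
  have hD0 : ∀ c (p : ℝ × ℝ), R < p.1 → D c p = 0 := fun c p hp => by
    have hnot : (p.1 * e p.2 : ℂ) ∉ tsupport F := fun h => by
      have := hR h
      rw [Metric.mem_closedBall, dist_zero_right, norm_mul, hen, mul_one, Complex.norm_real] at this
      exact absurd (le_trans (le_abs_self _) this) (not_le.2 hp)
    have : fderiv ℝ F (p.1 * e p.2) = 0 := by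
      by_contra h
      exact hnot (support_fderiv_subset ℝ h)
    simp [D, this]
  have hDi : ∀ c, IntegrableOn (D c) (Ioi (0 : ℝ) ×ˢ Ioo (-Real.pi) Real.pi) (volume.prod volume) := by
    intro c
    have h1 : IntegrableOn (D c) (Icc (0 : ℝ) R ×ˢ Icc (-Real.pi) Real.pi) (volume.prod volume) :=
      (hDc c).continuousOn.integrableOn_compact (isCompact_Icc.prod isCompact_Icc)
    refine h1.of_forall_sdiff_eq_zero (measurableSet_Ioi.prod measurableSet_Ioo) fun p hp => ?_
    refine hD0 c p ?_
    by_contra hle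
    exact hp.2 ⟨⟨hp.1.1.le, not_lt.1 hle⟩, Ioo_subset_Icc_self hp.1.2⟩
  -- Along each ray the radial derivative integrates to `-F 0`, and the rays fill an angle `2π`.
  have hrad : ∫ p in Ioi (0 : ℝ) ×ˢ Ioo (-Real.pi) Real.pi, D 1 p ∂(volume.prod volume)
      = -(2 * Real.pi) * F 0 := by
    have hDi1 := hDi 1
    rw [IntegrableOn, ← Measure.prod_restrict] at hDi1
    rw [← Measure.prod_restrict, integral_prod_symm _ hDi1]
    have : ∀ θ : ℝ, ∫ r in Ioi (0 : ℝ), D 1 (r, θ) = -F 0 := fun θ => by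
      have hder : ∀ r : ℝ, HasDerivAt (fun r : ℝ => F (r * e θ)) (D 1 (r, θ)) r := fun r => by
        have h1 : HasDerivAt (fun r : ℝ => (r : ℂ) * e θ) (1 * e θ) r :=
          (Complex.ofRealCLM.hasDerivAt (x := r)).mul_const _
        exact ((hd (r * e θ)).hasFDerivAt).comp_hasDerivAt r h1
      have hcs : HasCompactSupport (fun r : ℝ => F (r * e θ)) := by
        refine HasCompactSupport.of_support_subset_isCompact (isCompact_Icc (a := -R) (b := R))
          fun r hr => ?_
        have := hR (subset_tsupport F hr)
        rw [Metric.mem_closedBall, dist_zero_right, norm_mul, hen, mul_one, Complex.norm_real] at this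
        exact abs_le.1 this
      have h := hcs.integral_Ioi_deriv_eq ((hF.of_le (by simp)).comp
        (Complex.ofRealCLM.contDiff.mul contDiff_const)) 0
      rw [← (funext fun r => (hder r).deriv : deriv _ = fun r => D 1 (r, θ)), ]
      refine h.trans ?_
      simp
    simp_rw [this]
    rw [setIntegral_const, measureReal_def, Real.volume_Ioo, ENNReal.toReal_ofReal (by
      linarith [Real.pi_pos]), Complex.real_smul]
    push_cast
    ring
  -- On each circle the angular derivative integrates to zero by periodicity.
  have hang : ∫ p in Ioi (0 : ℝ) ×ˢ Ioo (-Real.pi) Real.pi, D Complex.I p ∂(volume.prod volume)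
      = 0 := by
    rw [setIntegral_prod _ (hDi _)]
    refine setIntegral_eq_zero_of_forall_eq_zero fun r hr => ?_
    have hr0 : (0 : ℝ) < r := hr
    have hder : ∀ θ : ℝ, HasDerivAt (fun θ => F (r * e θ)) (r * D Complex.I (r, θ)) θ := fun θ => by
      have h1 : HasDerivAt (fun θ => (r : ℂ) * e θ) (r * (Complex.I * e θ)) θ :=
        (hed θ).const_mul _
      have h2 := ((hd (r * e θ)).hasFDerivAt).comp_hasDerivAt θ h1
      convert! h2 using 1
      simp only [D]
      rw [← Complex.real_smul (x := r) (z := Complex.I * e θ), map_smul, Complex.real_smul]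
    have hft := intervalIntegral.integral_eq_sub_of_hasDerivAt (a := -Real.pi) (b := Real.pi)
      (fun θ _ => hder θ) ?_
    · rw [intervalIntegral.integral_const_mul] at hft
      have : e Real.pi = e (-Real.pi) := by simp [e]
      rw [this, sub_self, mul_eq_zero] at hft
      have h3 := hft.resolve_left (by exact_mod_cast hr0.ne')
      rwa [intervalIntegral.integral_of_le (by linarith [Real.pi_pos]),
        integral_Ioc_eq_integral_Ioo] at h3
    · refine Continuous.intervalIntegrable ?_ _ _
      have := (hDc Complex.I)
      fun_prop
  rw [← Complex.integral_comp_polarCoord_symm, polarCoord_target]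
  have hmain : ∀ p ∈ Ioi (0 : ℝ) ×ˢ Ioo (-Real.pi) Real.pi,
      p.1 • (dbar F (Complex.polarCoord.symm p) / Complex.polarCoord.symm p)
        = (1 / 2) * (D 1 p + Complex.I * D Complex.I p) := fun p hp => by
    have hp0 : (p.1 : ℂ) ≠ 0 := by exact_mod_cast (ne_of_gt (show (0 : ℝ) < p.1 from hp.1))
    have he0 : e p.2 ≠ 0 := by rw [← norm_pos_iff, hen]; exact one_pos
    have hpe : Complex.polarCoord.symm p = p.1 * e p.2 := by
      rw [Complex.polarCoord_symm_apply]
    rw [hpe]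
    set L := fderiv ℝ F (p.1 * e p.2) with hL
    have e1 : D 1 p = Real.cos p.2 * L 1 + Real.sin p.2 * L Complex.I := by
      have : (1 : ℂ) * e p.2 = Real.cos p.2 • (1 : ℂ) + Real.sin p.2 • Complex.I := by
        simp [e]
      simp only [D]
      rw [this, map_add, map_smul, map_smul, Complex.real_smul, Complex.real_smul]
    have e2 : D Complex.I p = -Real.sin p.2 * L 1 + Real.cos p.2 * L Complex.I := by
      have : Complex.I * e p.2 = (-Real.sin p.2) • (1 : ℂ) + Real.cos p.2 • Complex.I := by
        simp [e]
        linear_combination Complex.sin p.2 * Complex.I_mul_I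
      simp only [D]
      rw [this, map_add, map_smul, map_smul, Complex.real_smul, Complex.real_smul,
        Complex.ofReal_neg]
    have hcs : (Real.cos p.2 : ℂ) ^ 2 + (Real.sin p.2 : ℂ) ^ 2 = 1 := by
      exact_mod_cast Real.cos_sq_add_sin_sq p.2
    have e3 : e p.2 * (Real.cos p.2 - Complex.I * Real.sin p.2) = 1 := by
      simp only [e]
      linear_combination hcs - (Real.sin p.2 : ℂ) ^ 2 * Complex.I_mul_I
    rw [e1, e2, Complex.real_smul, dbar, ← hL]
    field_simp
    linear_combination (-(L 1 + Complex.I * L Complex.I)) * e3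
      - (e p.2 * (Real.sin p.2) * L Complex.I) * Complex.I_mul_I
  rw [setIntegral_congr_fun (measurableSet_Ioi.prod measurableSet_Ioo) hmain, integral_const_mul]
  have hDi' : ∀ c, IntegrableOn (D c) (Ioi (0 : ℝ) ×ˢ Ioo (-Real.pi) Real.pi) := hDi
  rw [integral_add (hDi' 1) ((hDi' Complex.I).const_mul _), integral_const_mul]
  rw [← Measure.volume_eq_prod] at hrad hang
  rw [hrad, hang]
  ring

theorem dbar_comp_const_add (f : ℂ → ℂ) (z s : ℂ) :
    dbar (fun s => f (z + s)) s = dbar f (z + s) := by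
  rw [dbar, fderiv_comp_add_left, dbar]

theorem dbar_exp {f : ℂ → ℂ} {z : ℂ} (hf : DifferentiableAt ℝ f z) :
    dbar (fun w => Complex.exp (f w)) z = Complex.exp (f z) * dbar f z := by
  have h := hf.hasFDerivAt.cexp
  rw [dbar, h.fderiv, dbar]
  simp only [smul_apply, smul_eq_mul]
  ring

/-- As a convolution with the locally integrable kernel `1 / (π t)`, the transform can be
differentiated by differentiating `f`. -/
theorem vekuaT_eq_integral_mul_sub {f : ℂ → ℂ} (hf : IsComplexTest f) :
    vekuaT f = fun z => ∫ t, (1 / (Real.pi : ℂ) * t⁻¹) * f (z - t) := by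
  ext z
  rw [vekuaT, setIntegral_eq_integral_of_forall_compl_eq_zero, ← integral_const_mul,
    ← integral_sub_left_eq_self _ volume z]
  · congr 1 with t
    rw [show z - t - z = -t by ring, div_neg]
    ring
  · intro ζ hζ
    rw [image_eq_zero_of_notMem_tsupport (fun h => hζ (hf.support h)), zero_div]

theorem contDiff_vekuaT {f : ℂ → ℂ} (hf : IsComplexTest f) : ContDiff ℝ ∞ (vekuaT f) := by
  rw [vekuaT_eq_integral_mul_sub hf]
  exact contDiff_integral_mul_sub hf.smooth hf.compact
    (locallyIntegrable_inv.smul (1 / (Real.pi : ℂ)))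

/-- Differentiation falls on `f` under the convolution, and what remains is Cauchy–Pompeiu for the
translate `s ↦ f (z + s)`. -/
theorem dbar_vekuaT {f : ℂ → ℂ} (hf : IsComplexTest f) (z : ℂ) : dbar (vekuaT f) z = f z := by
  have h := integral_dbar_div (F := fun s => f (z + s))
    (hf.smooth.comp (contDiff_const.add contDiff_id))
    (hf.compact.comp_homeomorph (Homeomorph.addLeft z))
  simp_rw [dbar_comp_const_add, add_zero] at h
  have hL : LocallyIntegrable (fun t : ℂ => 1 / (Real.pi : ℂ) * t⁻¹) :=
    locallyIntegrable_inv.smul (1 / (Real.pi : ℂ))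
  have hπ : (Real.pi : ℂ) ≠ 0 := by exact_mod_cast Real.pi_ne_zero
  rw [vekuaT_eq_integral_mul_sub hf, dbar_integral_mul_sub hf.smooth hf.compact hL,
    ← integral_neg_eq_self]
  calc _ = ∫ s, -(1 / (Real.pi : ℂ)) * (dbar f (z + s) / s) := by
        congr 1 with s
        rw [sub_neg_eq_add, inv_neg]
        ring
    _ = f z := by
        rw [integral_const_mul, h]
        field_simp

/-! ### Approximation by test functions and the product rule for `e^{T b}` -/

/-- A smooth approximant `g` need not be supported in the disk, so it is multiplied by a cutoff `χ`
equal to `1` on a large compact `K`. The error `(1 - χ) b + χ (b - g)` is small: its first term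
lives on `disk \ K`, its second is dominated by `b - g`. -/
theorem exists_complexTest_eLpNorm_sub_le {p : ENNReal} (hp : p ≠ ⊤) (hp1 : 1 ≤ p) {b : ℂ → ℂ}
    (hb : MemLp b p (volume.restrict disk)) {ε : ℝ} (hε : 0 < ε) :
    ∃ g, IsComplexTest g ∧ eLpNorm (b - g) p (volume.restrict disk) ≤ ENNReal.ofReal ε := by
  -- Absolute continuity of the `L^p` norm: `δ` says how small the measure of `disk \ K` has to be.
  obtain ⟨δ, hδ, hδb⟩ := hb.eLpNorm_indicator_le hp1 hp (half_pos hε)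
  obtain ⟨g, hgc, hgs, hg⟩ := hb.exist_eLpNorm_sub_le hp hp1 (half_pos hε)
  have hfin : volume disk ≠ ⊤ := (measure_ball_lt_top (x := (0 : ℂ)) (r := 1)).ne
  obtain ⟨K, hKd, hK, hKδ⟩ := measurableSet_disk.exists_isCompact_sdiff_lt hfin
    (ENNReal.ofReal_pos.2 hδ).ne'
  obtain ⟨χ, hχ1, hχ0, hχs, hχm⟩ : ∃ χ : ℂ → ℝ, (∀ x ∈ K, χ x = 1) ∧ IsTestFunction χ ∧
      (∀ x, 0 ≤ χ x) ∧ ∀ x, χ x ≤ 1 := by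
    obtain ⟨r, hr0, hr1, hKr⟩ : ∃ r : ℝ, 0 < r ∧ r < 1 ∧ K ⊆ Metric.closedBall 0 r := by
      rcases K.eq_empty_or_nonempty with rfl | hne
      · exact ⟨1 / 2, by norm_num, by norm_num, by simp⟩
      obtain ⟨x, hx, hmax⟩ := hK.exists_isMaxOn hne continuous_norm.continuousOn
      have hx1 : ‖x‖ < 1 := by simpa [disk] using hKd hx
      -- The maximum with `1 / 2` keeps the inner radius of the bump positive even when `K = {0}`.
      refine ⟨max ‖x‖ (1 / 2), by positivity, by simp [hx1]; norm_num, fun y hy => ?_⟩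
      simpa using Or.inl (hmax hy)
    obtain ⟨R, hrR, hR1⟩ := exists_between hr1
    let β : ContDiffBump (0 : ℂ) := ⟨r, R, hr0, hrR⟩
    refine ⟨β, fun x hx => β.one_of_mem_closedBall (hKr hx),
      ⟨β.contDiff, β.hasCompactSupport, ?_⟩, fun x => β.nonneg, fun x => β.le_one⟩
    rw [β.tsupport_eq]
    exact Metric.closedBall_subset_ball hR1
  refine ⟨fun z => χ z * g z, ⟨hχ0.ofReal.smooth.mul hgs, hχ0.ofReal.compact.mul_right,
    tsupport_mul_subset_left.trans hχ0.ofReal.support⟩, ?_⟩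
  have hμ : volume.restrict disk (disk \ K) ≤ ENNReal.ofReal δ :=
    (Measure.restrict_apply_le _ _).trans hKδ.le
  have h1 := hδb (disk \ K) (measurableSet_disk.diff hK.measurableSet) hμ
  have hbm := hb.aestronglyMeasurable
  have hgm : AEStronglyMeasurable g (volume.restrict disk) := hgs.continuous.aestronglyMeasurable
  have hχc : Continuous χ := hχ0.smooth.continuous
  have hχm' : AEStronglyMeasurable (fun z => (χ z : ℂ)) (volume.restrict disk) :=
    (Complex.continuous_ofReal.comp hχc).aestronglyMeasurable
  have e : b - (fun z => (χ z : ℂ) * g z)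
      = (fun z => (1 - (χ z : ℂ)) * b z) + fun z => (χ z : ℂ) * (b - g) z := by
    ext z; simp; ring
  rw [e]
  refine (eLpNorm_add_le ((aestronglyMeasurable_const.sub hχm').mul hbm)
    (hχm'.mul (hbm.sub hgm)) hp1).trans ?_
  rw [← add_halves ε, ENNReal.ofReal_add (half_pos hε).le (half_pos hε).le]
  refine add_le_add (le_trans (eLpNorm_mono_ae ?_) h1) (le_trans (eLpNorm_mono fun z => ?_) hg)
  · filter_upwards [ae_restrict_mem measurableSet_disk] with z hz
    by_cases hzK : z ∈ K
    · simp [hχ1 z hzK]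
    · rw [indicator_of_mem (show z ∈ disk \ K from ⟨hz, hzK⟩)]
      change ‖(1 - (χ z : ℂ)) * b z‖ ≤ _
      rw [norm_mul]
      refine mul_le_of_le_one_left (norm_nonneg _) ?_
      rw [← Complex.ofReal_one, ← Complex.ofReal_sub, Complex.norm_real, Real.norm_of_nonneg]
      · linarith [hχs z]
      · linarith [hχm z]
  · change ‖(χ z : ℂ) * (b - g) z‖ ≤ _
    rw [norm_mul]
    refine mul_le_of_le_one_left (norm_nonneg _) ?_
    rw [Complex.norm_real, Real.norm_of_nonneg (hχs z)]
    exact hχm z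

theorem IsComplexTest.memLp {g : ℂ → ℂ} (hg : IsComplexTest g) (p : ENNReal) :
    MemLp g p (volume.restrict disk) :=
  (hg.smooth.continuous.memLp_of_hasCompactSupport hg.compact)

/-- Every `L^q` function on the disk, `q > 2`, is the limit of test functions whose `T`-transforms
converge uniformly. -/
theorem exists_seq_vekuaT {q : ℝ} (hq : 2 < q) {b : ℂ → ℂ}
    (hb : MemLp b (ENNReal.ofReal q) (volume.restrict disk)) :
    IntegrableOn b disk ∧ ∃ g : ℕ → ℂ → ℂ, (∀ j, IsComplexTest (g j)) ∧
      TendstoUniformly (fun j => vekuaT (g j)) (vekuaT b) atTop ∧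
      Tendsto (fun j => ∫ z in disk, ‖g j z - b z‖) atTop (𝓝 0) := by
  obtain ⟨C, hC, hC1, hC2⟩ := exists_norm_vekuaT_le hq
  have hex : ∀ j : ℕ, ∃ g, IsComplexTest g ∧
      eLpNorm (b - g) (ENNReal.ofReal q) (volume.restrict disk)
        ≤ ENNReal.ofReal (1 / ((j : ℝ) + 1)) := fun j =>
    exists_complexTest_eLpNorm_sub_le (by simp) (by simp; linarith) hb (by positivity)
  choose g hg hgle using hex
  have hgm := fun j => (hg j).memLp (ENNReal.ofReal q)
  have hle : ∀ j : ℕ, C * (eLpNorm (b - g j) (ENNReal.ofReal q) (volume.restrict disk)).toReal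
      ≤ C * (1 / ((j : ℝ) + 1)) := fun j => by
    gcongr
    exact ENNReal.toReal_le_of_le_ofReal (by positivity) (hgle j)
  have hlim : Tendsto (fun j : ℕ => C * (1 / ((j : ℝ) + 1))) atTop (𝓝 0) := by
    simpa using (tendsto_one_div_add_atTop_nhds_zero_nat (𝕜 := ℝ)).const_mul C
  refine ⟨(hC1 b hb).1, g, hg, ?_, ?_⟩
  · rw [Metric.tendstoUniformly_iff]
    intro ε hε
    filter_upwards [hlim.eventually (gt_mem_nhds hε)] with j hj z
    rw [dist_eq_norm]
    exact (hC2 b (g j) hb (hgm j) z).trans_lt ((hle j).trans_lt hj)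
  · refine squeeze_zero (fun j => integral_nonneg fun z => norm_nonneg _) (fun j => ?_) hlim
    simp_rw [norm_sub_rev]
    exact ((hC1 _ (hb.sub (hgm j))).2).trans (hle j)

theorem continuous_vekuaT {q : ℝ} (hq : 2 < q) {b : ℂ → ℂ}
    (hb : MemLp b (ENNReal.ofReal q) (volume.restrict disk)) : Continuous (vekuaT b) := by
  obtain ⟨-, g, hg, hu, -⟩ := exists_seq_vekuaT hq hb
  exact hu.continuous (Frequently.of_forall fun j => (contDiff_vekuaT (hg j)).continuous)

/-- The product rule for the factor `e^{T b}`. -/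
theorem HasWeakDbar.exp_vekuaT_mul {q : ℝ} (hq : 2 < q) {b : ℂ → ℂ}
    (hb : MemLp b (ENNReal.ofReal q) (volume.restrict disk)) {u f : ℂ → ℂ}
    (h : HasWeakDbar Complex.I u f) (hu : ContinuousOn u disk) :
    HasWeakDbar Complex.I (fun z => Complex.exp (vekuaT b z) * u z)
      (fun z => Complex.exp (vekuaT b z) * (b z * u z + f z)) := by
  have hTc := continuous_vekuaT hq hb
  obtain ⟨hbi, g, hg, hgu, hgl⟩ := exists_seq_vekuaT hq hb
  have hlc : IsLocallyClosed disk := isOpen_disk.isLocallyClosed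
  have hbu : LocallyIntegrableOn (fun z => b z * u z) disk :=
    hbi.locallyIntegrableOn.mul_continuousOn hu hlc
  have hul := h.1
  have hfl := h.2.1
  rw [hasWeakDbar_iff_complexTest]
  refine ⟨hul.continuousOn_mul (by fun_prop) hlc, (hbu.add hfl).continuousOn_mul (by fun_prop) hlc,
    fun φ hφ => ?_⟩
  -- For the test functions `g j` the factor `E j = e^{T (g j)}` is smooth and the classical product
  -- rule applies; the claim is its limit as `j → ∞`.
  let E : ℕ → ℂ → ℂ := fun j z => Complex.exp (vekuaT (g j) z)
  have hEs : ∀ j, ContDiff ℝ ∞ (E j) := fun j => (contDiff_vekuaT (hg j)).cexp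
  have hEd : ∀ j z, dbar (E j) z = E j z * g j z := fun j z => by
    rw [dbar_exp ((contDiff_vekuaT (hg j)).differentiable (by simp) z), dbar_vekuaT (hg j)]
  have hElim : ∀ z, Tendsto (fun j => E j z) atTop (𝓝 (Complex.exp (vekuaT b z))) := fun z =>
    (Complex.continuous_exp.tendsto _).comp (hgu.tendsto_at z)
  -- `B` bounds `T b` on the closed disk, and `B + 1` eventually bounds every `T (g j)` there by
  -- uniform convergence.
  obtain ⟨M, hM0, hM⟩ : ∃ M : ℝ, 0 ≤ M ∧ ∀ᶠ j in atTop, ∀ z ∈ disk, ‖E j z‖ ≤ M := by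
    obtain ⟨B, hB⟩ := (isCompact_closedBall (0 : ℂ) 1).exists_bound_of_continuousOn
      hTc.continuousOn
    refine ⟨Real.exp (B + 1), (Real.exp_pos _).le, ?_⟩
    filter_upwards [Metric.tendstoUniformly_iff.1 hgu 1 one_pos] with j hj z hz
    rw [Complex.norm_exp]
    refine Real.exp_le_exp.2 ((Complex.re_le_norm _).trans ?_)
    have h1 := hj z
    rw [dist_comm, dist_eq_norm] at h1
    have h2 := hB z (Metric.ball_subset_closedBall hz)
    have h3 := norm_le_norm_add_norm_sub' (vekuaT (g j) z) (vekuaT b z)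
    linarith
  have hlimE : ∀ w : ℂ → ℂ, IntegrableOn w disk →
      Tendsto (fun j => ∫ z in disk, E j z * w z) atTop
        (𝓝 (∫ z in disk, Complex.exp (vekuaT b z) * w z)) := fun w hw => by
    refine tendsto_integral_filter_of_dominated_convergence (fun z => M * ‖w z‖) ?_ ?_
      (hw.norm.const_mul M) ?_
    · exact Eventually.of_forall fun j =>
        (hEs j).continuous.aestronglyMeasurable.mul hw.aestronglyMeasurable
    · filter_upwards [hM] with j hj
      filter_upwards [ae_restrict_mem measurableSet_disk] with z hz
      rw [norm_mul]
      exact mul_le_mul_of_nonneg_right (hj z hz) (norm_nonneg _)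
    · exact Eventually.of_forall fun z => (hElim z).mul_const _
  have i1 := hφ.integrableOn_dbar_mul hul
  have i2 := hφ.integrableOn_mul hfl
  have i3 := hφ.integrableOn_mul hbu
  obtain ⟨N, hN⟩ : ∃ N, ∀ z ∈ disk, ‖φ z * u z‖ ≤ N := by
    obtain ⟨N, hN⟩ := hφ.compact.exists_bound_of_continuousOn
      (f := fun z => φ z * u z) ((hφ.smooth.continuous.continuousOn).mul (hu.mono hφ.support))
    refine ⟨max N 0, fun z _ => ?_⟩
    by_cases hz : z ∈ tsupport φ
    · exact (hN z hz).trans (le_max_left _ _)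
    · simp [image_eq_zero_of_notMem_tsupport hz]
  -- Replacing `g j` by `b` in the product rule costs this term. It tends to zero because `E j` and
  -- `φ u` are bounded, the latter by continuity of `u`, and `g j → b` in `L^1`.
  have hrem : Tendsto (fun j => ∫ z in disk, E j z * (φ z * (u z * (g j z - b z)))) atTop
      (𝓝 0) := by
    have hl : Tendsto (fun j => (M * N) * ∫ z in disk, ‖g j z - b z‖) atTop (𝓝 0) := by
      simpa using hgl.const_mul (M * N)
    refine squeeze_zero_norm' ?_ hl
    filter_upwards [hM] with j hj
    rw [← integral_const_mul]
    refine norm_integral_le_of_norm_le ?_ ?_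
    · exact (((((hg j).smooth.continuous.integrable_of_hasCompactSupport
        (hg j).compact).integrableOn).sub hbi).norm).const_mul _
    · filter_upwards [ae_restrict_mem measurableSet_disk] with z hz
      rw [norm_mul, ← mul_assoc (φ z), norm_mul, ← mul_assoc]
      refine mul_le_mul_of_nonneg_right ?_ (norm_nonneg _)
      exact mul_le_mul (hj z hz) (hN z hz) (norm_nonneg _) hM0
  have heq : ∀ j, ∫ z in disk, E j z * (dbar φ z * u z)
      = - (∫ z in disk, E j z * (φ z * f z)) - (∫ z in disk, E j z * (φ z * (b z * u z)))
        - ∫ z in disk, E j z * (φ z * (u z * (g j z - b z))) := fun j => by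
    have hcE : ContinuousOn (E j) disk := (hEs j).continuous.continuousOn
    have hw := (hasWeakDbar_iff_complexTest.1 (h.mul_smooth (hEs j))).2.2 φ hφ
    have hgl' : LocallyIntegrableOn (fun z => u z * (g j z - b z)) disk :=
      ((((hg j).smooth.continuous.locallyIntegrable).locallyIntegrableOn _).sub
        hbi.locallyIntegrableOn).continuousOn_mul hu hlc
    have j1 := hφ.integrableOn_mul (hfl.continuousOn_mul hcE hlc)
    have j2 := hφ.integrableOn_mul (hbu.continuousOn_mul hcE hlc)
    have j3 := hφ.integrableOn_mul (hgl'.continuousOn_mul hcE hlc)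
    calc _ = ∫ z in disk, dbar φ z * (E j z * u z) := by
          congr 1 with z; ring
      _ = -∫ z in disk, ((φ z * (E j z * f z) + φ z * (E j z * (b z * u z)))
            + φ z * (E j z * (u z * (g j z - b z)))) := by
          rw [hw]
          congr 2 with z
          rw [hEd]; ring
      _ = _ := by
          rw [integral_add (by exact j1.add j2) j3, integral_add j1 j2, neg_add, neg_add,
            ← sub_eq_add_neg, ← sub_eq_add_neg]
          simp only [mul_left_comm (φ _)]
  have hl1 := hlimE _ i1
  have hl2 := ((hlimE _ i2).neg.sub (hlimE _ i3)).sub hrem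
  have key := tendsto_nhds_unique hl1 (hl2.congr fun j => (heq j).symm)
  have hcE : ContinuousOn (fun z => Complex.exp (vekuaT b z)) disk := by fun_prop
  have k1 := hφ.integrableOn_mul (hfl.continuousOn_mul hcE hlc)
  have k2 := hφ.integrableOn_mul (hbu.continuousOn_mul hcE hlc)
  calc _ = ∫ z in disk, Complex.exp (vekuaT b z) * (dbar φ z * u z) := by
        congr 1 with z; ring
    _ = -((∫ z in disk, φ z * (Complex.exp (vekuaT b z) * f z))
          + ∫ z in disk, φ z * (Complex.exp (vekuaT b z) * (b z * u z))) := by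
        rw [key]
        simp only [mul_left_comm (φ _)]
        ring
    _ = _ := by
        rw [← integral_add k1 k2]
        congr 2 with z
        ring

/-! ### Cauchy integrals on the unit circle and their boundary values -/

/-- The Cauchy integral over the unit circle. -/
def cauchyInt (H : ℂ → ℂ) (z : ℂ) : ℂ :=
  1 / (2 * Real.pi * Complex.I) * ∮ ζ in C(0, 1), H ζ / (ζ - z)

/-- The Cauchy integral over the unit circle, up to sign, at the reflected point `1 / z*`. -/
def cauchyExt (H : ℂ → ℂ) (z : ℂ) : ℂ :=
  conj z / (2 * Real.pi * Complex.I) * ∮ ζ in C(0, 1), H ζ / (1 - conj z * ζ)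

theorem mem_disk {z : ℂ} : z ∈ disk ↔ ‖z‖ < 1 := by simp [disk]

theorem sub_ne_zero_of_mem_disk {z ζ : ℂ} (hz : z ∈ disk) (hζ : ζ ∈ Metric.sphere (0 : ℂ) 1) :
    ζ - z ≠ 0 := by
  rw [sub_ne_zero]
  rintro rfl
  rw [mem_disk] at hz
  rw [mem_sphere_zero_iff_norm] at hζ
  exact absurd hζ hz.ne

theorem one_sub_conj_mul_ne_zero {z ζ : ℂ} (hz : z ∈ disk) (hζ : ‖ζ‖ ≤ 1) :
    1 - conj z * ζ ≠ 0 := by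
  rw [sub_ne_zero]
  intro h
  have h1 : ‖conj z * ζ‖ < 1 := by
    rw [norm_mul, Complex.norm_conj]
    exact (mul_le_of_le_one_right (norm_nonneg _) hζ).trans_lt (mem_disk.1 hz)
  rw [← h, norm_one] at h1
  exact lt_irrefl _ h1

theorem circleIntegrable_of_continuousOn {H : ℂ → ℂ} (hH : ContinuousOn H (Metric.sphere 0 1)) :
    CircleIntegrable H 0 1 :=
  hH.circleIntegrable zero_le_one

theorem continuousOn_div_sub {H : ℂ → ℂ} (hH : ContinuousOn H (Metric.sphere 0 1)) {z : ℂ}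
    (hz : z ∈ disk) : ContinuousOn (fun ζ => H ζ / (ζ - z)) (Metric.sphere 0 1) :=
  hH.div (by fun_prop) fun _ hζ => sub_ne_zero_of_mem_disk hz hζ

theorem continuousOn_div_one_sub {H : ℂ → ℂ} (hH : ContinuousOn H (Metric.sphere 0 1)) {z : ℂ}
    (hz : z ∈ disk) : ContinuousOn (fun ζ => H ζ / (1 - conj z * ζ)) (Metric.sphere 0 1) :=
  hH.div (by fun_prop) fun _ hζ =>
    one_sub_conj_mul_ne_zero hz (mem_sphere_zero_iff_norm.1 hζ).le

theorem differentiableOn_cauchyInt {H : ℂ → ℂ} (hH : ContinuousOn H (Metric.sphere 0 1)) :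
    DifferentiableOn ℂ (cauchyInt H) disk := by
  have h := hasFPowerSeriesOn_cauchy_integral (f := H) (c := 0) (R := 1)
    (circleIntegrable_of_continuousOn hH) one_pos
  have h2 := h.differentiableOn
  have hball : Metric.eball (0 : ℂ) (1 : NNReal) = disk := by
    rw [Metric.eball_coe]; rfl
  rw [hball] at h2
  refine h2.congr fun z _ => ?_
  simp only [cauchyInt, smul_eq_mul, one_div, NNReal.coe_one]
  congr 2 with ζ
  rw [div_eq_inv_mul]

/-- A holomorphic function with continuous boundary values is the Cauchy integral of these, and
their exterior Cauchy integral vanishes. -/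
theorem eq_cauchyInt_of_attainsBoundaryValues {h H : ℂ → ℂ} (hh : DifferentiableOn ℂ h disk)
    (hb : AttainsBoundaryValues h H) (hH : ContinuousOn H (Metric.sphere 0 1)) {z : ℂ}
    (hz : z ∈ disk) : h z = cauchyInt H z ∧ cauchyExt H z = 0 := by
  classical
  -- Gluing `h` to its boundary values gives a function continuous on the closed disk, to which
  -- Cauchy's theorems apply.
  let e : ℂ → ℂ := fun w => if w ∈ disk then h w else H w
  have heh : EqOn e h disk := fun w hw => if_pos hw
  have heH : ∀ w ∈ Metric.sphere (0 : ℂ) 1, e w = H w := fun w hw => if_neg fun hw' => by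
    rw [mem_disk] at hw'
    exact hw'.ne (mem_sphere_zero_iff_norm.1 hw)
  have hcl : Metric.closedBall (0 : ℂ) 1 = disk ∪ Metric.sphere 0 1 :=
    Metric.ball_union_sphere.symm
  have hed : DifferentiableOn ℂ e disk := hh.congr heh
  have he : DiffContOnCl ℂ e (Metric.ball 0 1) := by
    refine ⟨hed, ?_⟩
    rw [closure_ball _ one_ne_zero, hcl]
    intro w hw
    rcases hw with hw | hw
    · exact (hed.continuousOn.continuousAt (isOpen_disk.mem_nhds hw)).continuousWithinAt
    · refine ContinuousWithinAt.union ?_ ?_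
      · rw [ContinuousWithinAt, heH w hw]
        exact (hb.2 w hw).congr' (eventually_nhdsWithin_of_forall fun x hx => (heh hx).symm)
      · exact (hH w hw).congr heH (heH w hw)
  constructor
  · rw [← heh hz, ← he.two_pi_i_inv_smul_circleIntegral_sub_inv_smul hz, cauchyInt, one_div,
      smul_eq_mul]
    congr 1
    refine circleIntegral.integral_congr zero_le_one fun ζ hζ => ?_
    simp only [heH ζ hζ, smul_eq_mul, div_eq_inv_mul]
  -- The pole `1 / z*` of the reflected kernel lies outside the closed disk, so Cauchy's theorem
  -- gives zero.
  · have hd : DiffContOnCl ℂ (fun ζ => (1 - conj z * ζ)⁻¹ • e ζ) (Metric.ball 0 1) := by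
      refine DiffContOnCl.smul (DiffContOnCl.inv ?_ fun ζ hζ => ?_) he
      · exact Differentiable.diffContOnCl (by fun_prop)
      · rw [closure_ball _ one_ne_zero] at hζ
        exact one_sub_conj_mul_ne_zero hz (by simpa using hζ)
    rw [cauchyExt, circleIntegral.integral_congr (g := fun ζ => (1 - conj z * ζ)⁻¹ • e ζ)
      zero_le_one, hd.circleIntegral_eq_zero zero_le_one, mul_zero]
    intro ζ hζ
    simp only [heH ζ hζ, smul_eq_mul, div_eq_inv_mul]

theorem poissonKernel_zero (z ζ : ℂ) :
    poissonKernel 0 z ζ = (‖ζ‖ ^ 2 - ‖z‖ ^ 2) / ‖ζ - z‖ ^ 2 := by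
  simp [poissonKernel_def]

theorem continuousOn_poissonKernel {z : ℂ} (hz : z ∈ disk) :
    ContinuousOn (poissonKernel 0 z) (Metric.sphere 0 1) := by
  have : poissonKernel 0 z = fun ζ => (‖ζ‖ ^ 2 - ‖z‖ ^ 2) / ‖ζ - z‖ ^ 2 :=
    funext (poissonKernel_zero z)
  rw [this]
  refine ContinuousOn.div (by fun_prop) (by fun_prop) fun ζ hζ => ?_
  have := sub_ne_zero_of_mem_disk hz hζ
  positivity

theorem poissonKernel_nonneg {z ζ : ℂ} (hz : z ∈ disk) (hζ : ζ ∈ Metric.sphere (0 : ℂ) 1) :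
    0 ≤ poissonKernel 0 z ζ := by
  rw [poissonKernel_zero, mem_sphere_zero_iff_norm.1 hζ]
  have : ‖z‖ ^ 2 ≤ 1 := pow_le_one₀ (norm_nonneg z) (mem_disk.1 hz).le
  refine div_nonneg (by linarith) (by positivity)

/-- On the circle `ζ* = 1 / ζ`, so `ζ / (ζ - z) + z* ζ / (1 - z* ζ) = (1 - |z|²) / |ζ - z|²`, the
Poisson kernel; the extra factor `ζ` comes from `dζ = i ζ dθ`. -/
theorem cauchyInt_add_cauchyExt {H : ℂ → ℂ} (hH : ContinuousOn H (Metric.sphere 0 1)) {z : ℂ}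
    (hz : z ∈ disk) : cauchyInt H z + cauchyExt H z
      = Real.circleAverage (fun ζ => poissonKernel 0 z ζ • H ζ) 0 1 := by
  have e : cauchyInt H z + cauchyExt H z = (2 * Real.pi * Complex.I : ℂ)⁻¹ *
      ((∮ ζ in C(0, 1), H ζ / (ζ - z))
        + ∮ ζ in C(0, 1), conj z * (H ζ / (1 - conj z * ζ))) := by
    rw [cauchyInt, cauchyExt, circleIntegral.integral_const_mul]
    ring
  rw [e, Real.circleAverage_eq_circleIntegral one_ne_zero, smul_eq_mul,
    ← circleIntegral.integral_add]
  · congr 1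
    refine circleIntegral.integral_congr zero_le_one fun ζ hζ => ?_
    have h1 := sub_ne_zero_of_mem_disk hz hζ
    have h2 := one_sub_conj_mul_ne_zero hz (mem_sphere_zero_iff_norm.1 hζ).le
    have hζ1 := mem_sphere_zero_iff_norm.1 hζ
    have h0 : ζ ≠ 0 := by rw [← norm_pos_iff, hζ1]; exact one_pos
    have hcc : ζ * conj ζ = 1 := by rw [Complex.mul_conj, Complex.normSq_eq_norm_sq, hζ1]; simp
    have h3 : conj (ζ - z) ≠ 0 := (map_ne_zero _).2 h1
    have hP : ((poissonKernel 0 z ζ : ℝ) : ℂ)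
        = (1 - z * conj z) / ((ζ - z) * conj (ζ - z)) := by
      rw [poissonKernel_zero, hζ1, Complex.mul_conj, Complex.mul_conj, Complex.normSq_eq_norm_sq,
        Complex.normSq_eq_norm_sq]
      push_cast
      ring
    have h4 : 1 - conj z * ζ = ζ * conj (ζ - z) := by
      rw [map_sub]
      linear_combination -hcc
    simp only [Complex.real_smul, hP, smul_eq_mul, sub_zero]
    rw [h4]
    field_simp
    rw [map_sub]
    linear_combination (H ζ) * hcc
  · exact circleIntegrable_of_continuousOn (continuousOn_div_sub hH hz)
  · exact circleIntegrable_of_continuousOn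
      (continuousOn_const.mul (continuousOn_div_one_sub hH hz))

theorem norm_circleAverage_le {f : ℂ → ℂ} {g : ℂ → ℝ} (hg : CircleIntegrable g 0 1)
    (h : ∀ ζ ∈ Metric.sphere (0 : ℂ) 1, ‖f ζ‖ ≤ g ζ) :
    ‖Real.circleAverage f 0 1‖ ≤ Real.circleAverage g 0 1 := by
  rw [Real.circleAverage, Real.circleAverage, norm_smul, smul_eq_mul,
    Real.norm_of_nonneg (by positivity)]
  refine mul_le_mul_of_nonneg_left ?_ (by positivity)
  exact intervalIntegral.norm_integral_le_of_norm_le (by positivity)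
    (Eventually.of_forall fun θ _ => h _ (circleMap_mem_sphere 0 zero_le_one θ)) hg


/-- If the exterior Cauchy integral of continuous data vanishes, then their Cauchy integral attains
them as boundary values. -/
theorem attainsBoundaryValues_cauchyInt {H : ℂ → ℂ} (hH : ContinuousOn H (Metric.sphere 0 1))
    (h0 : ∀ z ∈ disk, cauchyExt H z = 0) : AttainsBoundaryValues (cauchyInt H) H := by
  refine ⟨(differentiableOn_cauchyInt hH).continuousOn, fun ζ₀ hζ₀ => ?_⟩
  -- As the exterior integral vanishes, the Cauchy integral is a Poisson integral; the kernel has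
  -- mean `1`, so the constant `H ζ₀` can be subtracted under it.
  have hrep : ∀ z ∈ disk, cauchyInt H z - H ζ₀
      = Real.circleAverage (fun ζ => poissonKernel 0 z ζ • (H ζ - H ζ₀)) 0 1 := fun z hz => by
    have h1 := cauchyInt_add_cauchyExt hH hz
    rw [h0 z hz, add_zero] at h1
    have h2 : Real.circleAverage (fun ζ => poissonKernel 0 z ζ • (fun _ : ℂ => H ζ₀) ζ) 0 1
        = H ζ₀ :=
      DiffContOnCl.circleAverage_poissonKernel_smul (f := fun _ => H ζ₀) diffContOnCl_const hz
    rw [h1]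
    conv_lhs => rw [← h2]
    rw [← Real.circleAverage_fun_sub]
    · simp only [smul_sub]
    · exact circleIntegrable_of_continuousOn ((continuousOn_poissonKernel hz).smul hH)
    · exact circleIntegrable_of_continuousOn
        ((continuousOn_poissonKernel hz).smul continuousOn_const)
  obtain ⟨M, hM⟩ := (isCompact_sphere (0 : ℂ) 1).exists_bound_of_continuousOn hH
  have hM0 : 0 ≤ M := (norm_nonneg _).trans (hM ζ₀ hζ₀)
  rw [Metric.tendsto_nhds]
  intro ε hε
  obtain ⟨δ, hδ, hδH⟩ := Metric.continuousWithinAt_iff.1 (hH ζ₀ hζ₀) (ε / 2) (half_pos hε)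
  -- This bounds the contribution of `dist ζ ζ₀ ≥ δ`: there `‖ζ - z‖ ≥ δ / 2` once `dist z ζ₀ < δ /
  -- 2`, and `‖H ζ - H ζ₀‖ ≤ 2 M`.
  have hlim : Tendsto (fun z : ℂ => 2 * M * ((1 - ‖z‖ ^ 2) / (δ / 2) ^ 2)) (𝓝[disk] ζ₀) (𝓝 0) := by
    have hc : Continuous (fun z : ℂ => 2 * M * ((1 - ‖z‖ ^ 2) / (δ / 2) ^ 2)) := by fun_prop
    have := (hc.tendsto ζ₀).mono_left (nhdsWithin_le_nhds (s := disk))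
    simpa [mem_sphere_zero_iff_norm.1 hζ₀] using this
  have hnear : ∀ᶠ z in 𝓝[disk] ζ₀, dist z ζ₀ < δ / 2 :=
    nhdsWithin_le_nhds (Metric.ball_mem_nhds ζ₀ (half_pos hδ))
  filter_upwards [self_mem_nhdsWithin, hnear, hlim.eventually (gt_mem_nhds (half_pos hε))]
    with z hz hzδ hzε
  have hPi : CircleIntegrable (fun ζ => poissonKernel 0 z ζ) 0 1 :=
    (continuousOn_poissonKernel hz).circleIntegrable zero_le_one
  have hP1 : Real.circleAverage (fun ζ => poissonKernel 0 z ζ) 0 1 = 1 := by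
    have h2 := DiffContOnCl.circleAverage_poissonKernel_smul (f := fun _ => (1 : ℂ)) (R := 1)
      (c := 0) diffContOnCl_const hz
    have h3 := Complex.ofRealCLM.circleAverage_comp_comm hPi
    have h4 : (Complex.ofRealCLM ∘ fun ζ => poissonKernel 0 z ζ)
        = poissonKernel 0 z • fun _ => (1 : ℂ) := by
      ext ζ; simp
    rw [h4, h2, Complex.ofRealCLM_apply] at h3
    exact_mod_cast h3.symm
  rw [dist_eq_norm, hrep z hz]
  set c := 2 * M * ((1 - ‖z‖ ^ 2) / (δ / 2) ^ 2) with hc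
  have hz1 : ‖z‖ ^ 2 ≤ 1 := pow_le_one₀ (norm_nonneg z) (mem_disk.1 hz).le
  have hc0 : 0 ≤ c := mul_nonneg (by positivity) (div_nonneg (by linarith) (by positivity))
  have hgi : CircleIntegrable (fun ζ => (ε / 2) • poissonKernel 0 z ζ + c) 0 1 :=
    (((continuousOn_poissonKernel hz).const_smul (ε / 2)).add continuousOn_const).circleIntegrable
      zero_le_one
  refine (norm_circleAverage_le hgi fun ζ hζ => ?_).trans_lt ?_
  · have hPn := poissonKernel_nonneg hz hζ
    rw [norm_smul, Real.norm_of_nonneg hPn, smul_eq_mul]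
    rcases lt_or_ge (dist ζ ζ₀) δ with hd | hd
    · have h1 := hδH hζ hd
      rw [dist_eq_norm] at h1
      have := mul_le_mul_of_nonneg_left h1.le hPn
      linarith
    · have h1 : δ / 2 ≤ ‖ζ - z‖ := by
        have := dist_triangle ζ z ζ₀
        rw [dist_eq_norm ζ z] at this
        linarith
      have h2 : poissonKernel 0 z ζ ≤ (1 - ‖z‖ ^ 2) / (δ / 2) ^ 2 := by
        rw [poissonKernel_zero, mem_sphere_zero_iff_norm.1 hζ, one_pow]
        gcongr
      have h3 : ‖H ζ - H ζ₀‖ ≤ 2 * M := (norm_sub_le _ _).trans (by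
        have := hM ζ hζ; have := hM ζ₀ hζ₀; linarith)
      have h4 := mul_le_mul h2 h3 (norm_nonneg _) (hPn.trans h2)
      have h5 := mul_nonneg (half_pos hε).le hPn
      rw [hc]
      linarith
  · rw [Real.circleAverage_fun_add _ (circleIntegrable_const _ _ _), Real.circleAverage_fun_smul,
      hP1, Real.circleAverage_const, smul_eq_mul]
    · linarith
    · exact ((continuousOn_poissonKernel hz).const_smul (ε / 2)).circleIntegrable zero_le_one

/-! ### Exponentials of the nilpotent shift and polyanalytic functions -/

/-- The triangular exponential sums `∑ c ^ (l - k) / (l - k)! * x l` over `k ≤ l < n`. -/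
def tri (c : ℂ) (n : ℕ) (x : ℕ → ℂ) (k : ℕ) : ℂ :=
  ∑ l ∈ Finset.Ico k n, c ^ (l - k) / ((l - k).factorial : ℂ) * x l

theorem tri_congr {c : ℂ} {n : ℕ} {x y : ℕ → ℂ} (h : ∀ l < n, x l = y l) (k : ℕ) :
    tri c n x k = tri c n y k :=
  Finset.sum_congr rfl fun l hl => by rw [h l (Finset.mem_Ico.1 hl).2]

theorem tri_of_le {c : ℂ} {n k : ℕ} (h : n ≤ k) (x : ℕ → ℂ) : tri c n x k = 0 := by
  rw [tri, Finset.Ico_eq_empty_of_le h, Finset.sum_empty]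

theorem tri_fun_zero (c : ℂ) (n k : ℕ) : tri c n (fun _ => 0) k = 0 := by simp [tri]

theorem tri_zero {n k : ℕ} (hk : k < n) (x : ℕ → ℂ) : tri 0 n x k = x k := by
  rw [tri, Finset.sum_eq_sum_Ico_succ_bot hk, Finset.sum_eq_zero]
  · simp
  · intro l hl
    have : l - k ≠ 0 := by have := (Finset.mem_Ico.1 hl).1; omega
    rw [zero_pow this]; simp

theorem sum_Ico_pow_div_factorial (c d : ℂ) {k l : ℕ} (hkl : k ≤ l) :
    ∑ m ∈ Finset.Ico k (l + 1), c ^ (m - k) / ((m - k).factorial : ℂ)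
        * (d ^ (l - m) / ((l - m).factorial : ℂ))
      = (c + d) ^ (l - k) / ((l - k).factorial : ℂ) := by
  obtain ⟨N, rfl⟩ := Nat.exists_eq_add_of_le hkl
  rw [Finset.sum_Ico_eq_sum_range, show k + N + 1 - k = N + 1 by omega,
    show k + N - k = N by omega, add_pow, Finset.sum_div]
  refine Finset.sum_congr rfl fun m hm => ?_
  have hmN : m ≤ N := Nat.lt_succ_iff.1 (Finset.mem_range.1 hm)
  rw [show k + m - k = m by omega, show k + N - (k + m) = N - m by omega,
    Nat.cast_choose ℂ hmN]
  have h1 : (N.factorial : ℂ) ≠ 0 := by exact_mod_cast N.factorial_ne_zero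
  have h2 : (m.factorial : ℂ) ≠ 0 := by exact_mod_cast m.factorial_ne_zero
  have h3 : ((N - m).factorial : ℂ) ≠ 0 := by exact_mod_cast (N - m).factorial_ne_zero
  field_simp

/-- For `k < n`, `tri c n` is `exp(c N)` with `N` the shift on sequences of length `n`. This is the
group law `exp(c N) exp(d N) = exp((c + d) N)`, that is, the binomial theorem. -/
theorem tri_tri (c d : ℂ) (n : ℕ) (x : ℕ → ℂ) (k : ℕ) :
    tri c n (tri d n x) k = tri (c + d) n x k := by
  simp only [tri, Finset.mul_sum]
  rw [Finset.sum_Ico_Ico_comm]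
  refine Finset.sum_congr rfl fun l hl => ?_
  rw [← sum_Ico_pow_div_factorial c d (Finset.mem_Ico.1 hl).1, Finset.sum_mul]
  refine Finset.sum_congr rfl fun m _ => ?_
  ring

/-- `exp(c N)` is invertible, with inverse `exp(-c N)`. -/
theorem tri_eq_zero_iff {c : ℂ} {n : ℕ} {x : ℕ → ℂ} :
    (∀ k < n, tri c n x k = 0) ↔ ∀ k < n, x k = 0 := by
  constructor
  · intro h k hk
    have e := tri_tri (-c) c n x k
    rwa [neg_add_cancel, tri_zero hk, tri_congr h, tri_fun_zero, eq_comm] at e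
  · intro h k _
    rw [tri_congr h, tri_fun_zero]

theorem dbar_const_mul_conj_pow (s : ℂ) (m : ℕ) (z : ℂ) :
    dbar (fun w => (s * conj w) ^ m / (m.factorial : ℂ)) z
      = if m = 0 then 0 else s * ((s * conj z) ^ (m - 1) / ((m - 1).factorial : ℂ)) := by
  have h1 : HasFDerivAt (fun w : ℂ => conj w) (Complex.conjCLE : ℂ →L[ℝ] ℂ) z :=
    Complex.conjCLE.hasFDerivAt
  have h2 := ((h1.const_mul s).pow m).mul_const ((m.factorial : ℂ)⁻¹)
  simp_rw [div_eq_mul_inv]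
  rw [dbar, h2.fderiv]
  rcases m with _ | m
  · simp
  · have h3 : ((m + 1 : ℕ) : ℂ) ≠ 0 := by exact_mod_cast m.succ_ne_zero
    have h4 : (m.factorial : ℂ) ≠ 0 := by exact_mod_cast m.factorial_ne_zero
    simp only [Nat.add_sub_cancel, Nat.factorial_succ, Nat.cast_mul, smul_apply, smul_eq_mul,
      ContinuousLinearEquiv.coe_coe, Complex.conjCLE_apply, map_one, Complex.conj_I, nsmul_eq_mul,
      if_neg (Nat.succ_ne_zero m)]
    field_simp
    linear_combination -s * (s * conj z) ^ m * Complex.I_mul_I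

theorem contDiff_const_mul_conj_pow (s : ℂ) (m : ℕ) :
    ContDiff ℝ ∞ (fun w => (s * conj w) ^ m / (m.factorial : ℂ)) := by
  have h : ContDiff ℝ ∞ (fun w : ℂ => conj w) := Complex.conjCLE.contDiff
  exact ((contDiff_const.mul h).pow m).div_const _

/-- Leibniz rule: `∂/∂z*` of `exp(s z* N) v` is `exp(s z* N) ∂v/∂z* + s N exp(s z* N) v`, and `N`
raises the index `k` by one. -/
theorem hasWeakDbar_tri (s : ℂ) (n : ℕ) {v v' : ℕ → ℂ → ℂ}
    (h : ∀ l < n, HasWeakDbar Complex.I (v l) (v' l)) (k : ℕ) :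
    HasWeakDbar Complex.I (fun z => tri (s * conj z) n (fun l => v l z) k)
      (fun z => tri (s * conj z) n (fun l => v' l z) k
        + s * tri (s * conj z) n (fun l => v l z) (k + 1)) := by
  have h1 := hasWeakDbar_sum (Finset.Ico k n) fun l hl =>
    (h l (Finset.mem_Ico.1 hl).2).mul_smooth (contDiff_const_mul_conj_pow s (l - k))
  convert! h1 using 2 with z
  rw [Finset.sum_add_distrib]
  congr 1
  simp only [dbar_const_mul_conj_pow]
  rcases lt_or_ge k n with hk | hk
  · rw [Finset.sum_eq_sum_Ico_succ_bot hk, Nat.sub_self, if_pos rfl, zero_mul, zero_add, tri,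
      Finset.mul_sum]
    refine Finset.sum_congr rfl fun l hl => ?_
    have hl' := (Finset.mem_Ico.1 hl).1
    rw [if_neg (by omega), show l - k - 1 = l - (k + 1) by omega]
    ring
  · rw [tri_of_le (by omega), Finset.Ico_eq_empty_of_le hk]; simp

theorem AttainsBoundaryValues.mul {v g m : ℂ → ℂ} (h : AttainsBoundaryValues v g)
    (hm : Continuous m) : AttainsBoundaryValues (fun z => m z * v z) (fun z => m z * g z) :=
  ⟨hm.continuousOn.mul h.1, fun ζ hζ =>
    ((hm.tendsto ζ).mono_left nhdsWithin_le_nhds).mul (h.2 ζ hζ)⟩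

theorem AttainsBoundaryValues.congr {v g v' g' : ℂ → ℂ} (h : AttainsBoundaryValues v g)
    (hv : EqOn v v' disk) (hg : EqOn g g' (Metric.sphere 0 1)) : AttainsBoundaryValues v' g' :=
  ⟨h.1.congr hv.symm, fun ζ hζ => by
    rw [← hg hζ]
    exact (h.2 ζ hζ).congr' (eventually_nhdsWithin_of_forall hv)⟩

theorem attainsBoundaryValues_tri {c : ℂ → ℂ} (hc : Continuous c) {n : ℕ} {v g : ℕ → ℂ → ℂ}
    (h : ∀ l < n, AttainsBoundaryValues (v l) (g l)) (k : ℕ) :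
    AttainsBoundaryValues (fun z => tri (c z) n (fun l => v l z) k)
      (fun z => tri (c z) n (fun l => g l z) k) := by
  have hl : ∀ l ∈ Finset.Ico k n, AttainsBoundaryValues
      (fun z => c z ^ (l - k) / ((l - k).factorial : ℂ) * v l z)
      (fun z => c z ^ (l - k) / ((l - k).factorial : ℂ) * g l z) := fun l hl =>
    (h l (Finset.mem_Ico.1 hl).2).mul (m := fun z => c z ^ (l - k) / ((l - k).factorial : ℂ))
      (by fun_prop)
  exact ⟨continuousOn_finsetSum _ fun l hl' => (hl l hl').1,
    fun ζ hζ => tendsto_finsetSum _ fun l hl' => (hl l hl').2 ζ hζ⟩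

theorem continuousOn_tri {c : ℂ → ℂ} (hc : Continuous c) {n : ℕ} {g : ℕ → ℂ → ℂ} {s : Set ℂ}
    (h : ∀ l < n, ContinuousOn (g l) s) (k : ℕ) :
    ContinuousOn (fun z => tri (c z) n (fun l => g l z) k) s :=
  continuousOn_finsetSum _ fun l hl =>
    ContinuousOn.mul (by fun_prop) (h l (Finset.mem_Ico.1 hl).2)

theorem circleIntegral_sum {ι : Type*} (s : Finset ι) {f : ι → ℂ → ℂ}
    (h : ∀ i ∈ s, ContinuousOn (f i) (Metric.sphere 0 1)) :
    ∮ ζ in C(0, 1), ∑ i ∈ s, f i ζ = ∑ i ∈ s, ∮ ζ in C(0, 1), f i ζ :=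
  circleIntegral.integral_fun_sum fun i hi => circleIntegrable_of_continuousOn (h i hi)

/-- The boundary data of the holomorphic components of a polyanalytic function. -/
def holoData (n : ℕ) (G : ℕ → ℂ → ℂ) (l : ℕ) (ζ : ℂ) : ℂ := tri (-conj ζ) n (fun i => G i ζ) l

theorem continuousOn_holoData {n : ℕ} {G : ℕ → ℂ → ℂ}
    (hG : ∀ l < n, ContinuousOn (G l) (Metric.sphere 0 1)) (l : ℕ) :
    ContinuousOn (holoData n G l) (Metric.sphere 0 1) :=
  continuousOn_tri (Complex.continuous_conj.neg) hG l

/-- The powers of `-(ζ - z)*` are the entries of `exp(z* N) exp(-ζ* N)`. The first factor is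
constant in `ζ` and leaves the integral; the second turns `G` into `holoData`. -/
theorem sum_circleIntegral_eq_tri {n : ℕ} {G : ℕ → ℂ → ℂ}
    (hG : ∀ l < n, ContinuousOn (G l) (Metric.sphere 0 1)) {K : ℂ → ℂ}
    (hK : ContinuousOn K (Metric.sphere 0 1)) (z : ℂ) (k : ℕ) :
    ∑ l ∈ Finset.Ico k n, ∮ ζ in C(0, 1), (-1) ^ (l - k) * (G l ζ * K ζ) *
        (conj (ζ - z) ^ (l - k) / ((l - k).factorial : ℂ))
      = tri (conj z) n (fun l => ∮ ζ in C(0, 1), holoData n G l ζ * K ζ) k := by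
  rw [← circleIntegral_sum, tri]
  · simp_rw [← circleIntegral.integral_const_mul]
    rw [← circleIntegral_sum]
    · congr 1
      ext ζ
      have h := tri_tri (conj z) (-conj ζ) n (fun i => G i ζ) k
      calc _ = tri (conj z + -conj ζ) n (fun i => G i ζ) k * K ζ := by
            rw [tri, Finset.sum_mul]
            refine Finset.sum_congr rfl fun l _ => ?_
            rw [show conj z + -conj ζ = (-1) * conj (ζ - z) by rw [map_sub]; ring, mul_pow]
            ring
        _ = _ := by
            rw [← h, tri, Finset.sum_mul]
            refine Finset.sum_congr rfl fun l _ => ?_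
            rw [holoData]
            ring
    · intro l _
      exact continuousOn_const.mul ((continuousOn_holoData hG l).mul hK)
  · intro l hl
    have := hG l (Finset.mem_Ico.1 hl).2
    exact (continuousOn_const.mul (this.mul hK)).mul (by fun_prop)

/-- For fixed `z` the `n` conditions say that `exp(z* N)` kills the vector of exterior integrals,
and `exp(z* N)` is invertible. -/
theorem cauchyConditions_iff {n : ℕ} {a : ℂ → ℂ} {g : ℕ → ℂ → ℂ}
    (hG : ∀ l < n, ContinuousOn (fun ζ => g l ζ * Complex.exp (-vekuaT a ζ)) (Metric.sphere 0 1)) :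
    CauchyConditions n a g ↔ ∀ l < n, ∀ z ∈ disk,
      cauchyExt (holoData n (fun l ζ => g l ζ * Complex.exp (-vekuaT a ζ)) l) z = 0 := by
  set G : ℕ → ℂ → ℂ := fun l ζ => g l ζ * Complex.exp (-vekuaT a ζ) with hGdef
  have key : ∀ z ∈ disk, ∀ k, ∑ l ∈ Finset.Ico k n,
      conj z / (2 * Real.pi * Complex.I) *
        (∮ ζ in C(0, 1), (-1) ^ (l - k) *
          (g l ζ * Complex.exp (-vekuaT a ζ) / (1 - conj z * ζ)) *
          (conj (ζ - z) ^ (l - k) / ((l - k).factorial : ℂ)))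
      = tri (conj z) n (fun l => cauchyExt (holoData n G l) z) k := fun z hz k => by
    have h := sum_circleIntegral_eq_tri hG (K := fun ζ => 1 / (1 - conj z * ζ))
      (continuousOn_div_one_sub (H := fun _ => 1) continuousOn_const hz) z k
    simp only [mul_one_div] at h
    rw [← Finset.mul_sum, h, tri, tri, Finset.mul_sum]
    refine Finset.sum_congr rfl fun l _ => ?_
    rw [cauchyExt]
    ring
  constructor
  · intro h l hl z hz
    refine tri_eq_zero_iff (c := conj z) (x := fun l => cauchyExt (holoData n G l) z) |>.1
      (fun k hk => ?_) l hl
    rw [← key z hz]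
    exact h z hz k hk
  · intro h z hz k hk
    rw [key z hz]
    exact tri_eq_zero_iff.2 (fun l hl => h l hl z hz) k hk

theorem cauchyPhi_eq {n : ℕ} {a : ℂ → ℂ} {g : ℕ → ℂ → ℂ}
    (hG : ∀ l < n, ContinuousOn (fun ζ => g l ζ * Complex.exp (-vekuaT a ζ)) (Metric.sphere 0 1))
    {z : ℂ} (hz : z ∈ disk) :
    cauchyPhi n a g z = tri (conj z) n (fun l =>
      cauchyInt (holoData n (fun l ζ => g l ζ * Complex.exp (-vekuaT a ζ)) l) z) 0 := by
  have h := sum_circleIntegral_eq_tri hG (K := fun ζ => 1 / (ζ - z))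
    (continuousOn_div_sub (H := fun _ => 1) continuousOn_const hz) z 0
  simp only [mul_one_div, Nat.sub_zero, ← Finset.range_eq_Ico] at h
  calc cauchyPhi n a g z = 1 / (2 * Real.pi * Complex.I) * ∑ l ∈ Finset.range n,
        ∮ ζ in C(0, 1), (-1) ^ l * (g l ζ * Complex.exp (-vekuaT a ζ) / (ζ - z)) *
          (conj (ζ - z) ^ l / (l.factorial : ℂ)) := by
        rw [cauchyPhi, Finset.mul_sum]
        refine Finset.sum_congr rfl fun l _ => ?_
        have e : ∀ ζ : ℂ, (-1) ^ l * (g l ζ * Complex.exp (-vekuaT a ζ) / (ζ - z)) *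
            (conj (ζ - z) ^ l / (l.factorial : ℂ)) = (-1) ^ l *
            (g l ζ * Complex.exp (-vekuaT a ζ) / (l.factorial : ℂ) *
              (conj (ζ - z) ^ l / (ζ - z))) := fun ζ => by ring
        simp_rw [e]
        rw [circleIntegral.integral_const_mul]
        ring
    _ = _ := by
        rw [h, tri, tri, Finset.mul_sum]
        refine Finset.sum_congr rfl fun l _ => ?_
        rw [cauchyInt]
        ring

/-! ### The scalar Dirichlet problem -/

theorem IsVekuaIterate.ae_unique {a w : ℂ → ℂ} {k : ℕ} {v v' : ℂ → ℂ}
    (h : IsVekuaIterate Complex.I a k w v) (h' : IsVekuaIterate Complex.I a k w v') :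
    v =ᵐ[volume.restrict disk] v' := by
  induction k generalizing v v' with
  | zero =>
    filter_upwards [ae_restrict_mem measurableSet_disk] with z hz
    exact (h hz).trans (h' hz).symm
  | succ k ih =>
    obtain ⟨u, hu, hd⟩ := h
    obtain ⟨u', hu', hd'⟩ := h'
    have e := ih hu hu'
    filter_upwards [hd.ae_unique hd' e, e] with z h1 h2
    rw [h2] at h1
    exact add_left_cancel h1

/-- An iterate is determined only almost everywhere, and each one hides its own predecessor. Any
representative may replace it, so the continuous representatives attaining the boundary data link
into a chain. -/
theorem hasWeakDbar_of_isVekuaIterate {a w : ℂ → ℂ} {k : ℕ} {v v' : ℂ → ℂ}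
    (h : IsVekuaIterate Complex.I a k w v) (h' : IsVekuaIterate Complex.I a (k + 1) w v') :
    HasWeakDbar Complex.I v (fun z => a z * v z + v' z) := by
  obtain ⟨u, hu, hd⟩ := h'
  have e := hu.ae_unique h
  refine hd.congr_ae e ?_
  filter_upwards [e] with z hz
  rw [hz]

/-- The scalar Dirichlet problem is solvable iff the Cauchy-type conditions hold, and the solution
is then given by the explicit formula. -/
theorem solvesDirichlet_iff {n : ℕ} (hn : 0 < n) {q : ℝ} (hq : 2 < q) {a : ℂ → ℂ}
    (ha : MemLp a (ENNReal.ofReal q) (volume.restrict disk)) {g : ℕ → ℂ → ℂ}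
    (hg : ∀ k < n, ContinuousOn (g k) (Metric.sphere 0 1)) (f : ℂ → ℂ) :
    SolvesDirichlet Complex.I n a g f ↔ CauchyConditions n a g ∧
      EqOn f (fun z => Complex.exp (vekuaT a z) * cauchyPhi n a g z) disk := by
  have hT := continuous_vekuaT hq ha
  have hG : ∀ l < n, ContinuousOn (fun ζ => g l ζ * Complex.exp (-vekuaT a ζ))
      (Metric.sphere 0 1) := fun l hl => (hg l hl).mul (by fun_prop)
  rw [cauchyConditions_iff hG]
  have hphi := fun z hz => cauchyPhi_eq hG (z := z) hz
  set G : ℕ → ℂ → ℂ := fun l ζ => g l ζ * Complex.exp (-vekuaT a ζ) with hGdef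
  have hHc := continuousOn_holoData hG
  constructor
  · rintro ⟨hnull, hbd⟩
    choose! v hv hvb using hbd
    -- The boundary conditions supply representatives only for `k < n`; the `n`-th is the zero
    -- function.
    let V : ℕ → ℂ → ℂ := fun k => if k < n then v k else fun _ => 0
    have hVlt : ∀ k < n, V k = v k := fun k hk => if_pos hk
    have hVn : V n = fun _ => 0 := if_neg (lt_irrefl n)
    have hVit : ∀ k ≤ n, IsVekuaIterate Complex.I a k f (V k) := fun k hk => by
      rcases hk.lt_or_eq with h | rfl
      · rw [hVlt k h]; exact hv k h
      · rw [hVn]; exact hnull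
    have hVb : ∀ k < n, AttainsBoundaryValues (V k) (g k) := fun k hk => by
      rw [hVlt k hk]; exact hvb k hk
    let W : ℕ → ℂ → ℂ := fun k z => Complex.exp (-vekuaT a z) * V k z
    have hWb : ∀ k < n, AttainsBoundaryValues (W k) (G k) := fun k hk =>
      ((hVb k hk).mul (m := fun z => Complex.exp (-vekuaT a z)) (by fun_prop)).congr
        (fun _ _ => rfl) fun ζ _ => mul_comm _ _
    have hWd : ∀ k < n, HasWeakDbar Complex.I (W k) (W (k + 1)) := fun k hk => by
      have h1 := hasWeakDbar_of_isVekuaIterate (hVit k hk.le) (hVit (k + 1) hk)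
      have h2 := h1.exp_vekuaT_mul hq ha.neg (hVb k hk).1
      have e : vekuaT (-a) = fun z => -vekuaT a z := funext fun z => vekuaT_neg a z
      rw [e] at h2
      convert! h2 using 2 with z
      simp only [W, Pi.neg_apply]
      ring
    -- This is `exp(-z* N) W`, whose two Leibniz terms cancel because `∂W/∂z* = N W`.
    let h : ℕ → ℂ → ℂ := fun l z => tri (-1 * conj z) n (fun i => W i z) l
    have hhb : ∀ l, AttainsBoundaryValues (h l) (holoData n G l) := fun l =>
      (attainsBoundaryValues_tri (c := fun z => -1 * conj z)
        (continuous_const.mul Complex.continuous_conj) hWb l).congr (fun _ _ => rfl)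
        fun ζ _ => by simp only [holoData, neg_one_mul]
    have hhd : ∀ l, DifferentiableOn ℂ (h l) disk := fun l => by
      refine HasWeakDbar.differentiableOn ?_ (hhb l).1
      have h1 := hasWeakDbar_tri (-1) n hWd l
      convert! h1 using 2 with z
      rcases lt_or_ge l n with hl | hl
      -- The left sum has one more term than the right; that term contains `W n = 0`.
      · have e : tri (-1 * conj z) n (fun i => W (i + 1) z) l
            = tri (-1 * conj z) n (fun i => W i z) (l + 1) := by
          obtain ⟨N, rfl⟩ := Nat.exists_eq_add_of_lt hl
          have hW0 : W (l + N + 1) z = 0 := by simp only [W, hVn, mul_zero]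
          rw [tri, tri, Finset.sum_Ico_eq_sum_range, Finset.sum_Ico_eq_sum_range,
            show l + N + 1 - l = N + 1 by omega, show l + N + 1 - (l + 1) = N by omega,
            Finset.sum_range_succ, hW0, mul_zero, add_zero]
          refine Finset.sum_congr rfl fun i _ => ?_
          rw [show l + i - l = i by omega, show l + 1 + i - (l + 1) = i by omega,
            show l + i + 1 = l + 1 + i by omega]
        rw [e]; ring
      · rw [tri_of_le hl, tri_of_le (by omega)]; simp
    have hhC := fun l z hz => eq_cauchyInt_of_attainsBoundaryValues (z := z) (hhd l) (hhb l)
      (hHc l) hz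
    refine ⟨fun l _ z hz => (hhC l z hz).2, fun z hz => ?_⟩
    have hW0 : cauchyPhi n a g z = W 0 z := by
      -- `W = exp(z* N) exp(-z* N) W = exp(z* N) h`, read off at index `0`.
      rw [hphi z hz, ← tri_zero hn (fun i => W i z), ← add_neg_cancel (conj z), ← tri_tri]
      refine tri_congr (fun l _ => ?_) 0
      rw [← (hhC l z hz).1]
      simp only [h, neg_one_mul]
    have hf : V 0 z = f z := hVit 0 hn.le hz
    simp only [hW0, W, hf]
    rw [← mul_assoc, ← Complex.exp_add, add_neg_cancel, Complex.exp_zero, one_mul]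
  · rintro ⟨hext, hf⟩
    let h : ℕ → ℂ → ℂ := fun l => cauchyInt (holoData n G l)
    have hhb : ∀ l < n, AttainsBoundaryValues (h l) (holoData n G l) := fun l hl =>
      attainsBoundaryValues_cauchyInt (hHc l) (hext l hl)
    have hhd : ∀ l < n, HasWeakDbar Complex.I (h l) (fun _ => 0) := fun l _ =>
      hasWeakDbar_of_differentiableOn (differentiableOn_cauchyInt (hHc l))
    let W : ℕ → ℂ → ℂ := fun k z => tri (1 * conj z) n (fun i => h i z) k
    have hWd : ∀ k, HasWeakDbar Complex.I (W k) (W (k + 1)) := fun k => by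
      have h1 := hasWeakDbar_tri 1 n hhd k
      simp only [tri_fun_zero, zero_add] at h1
      convert! h1 using 2 with z
      rw [one_mul]
    -- At a boundary point `exp(ζ* N)` undoes the `exp(-ζ* N)` in `holoData` and returns `G`.
    have hWb : ∀ k < n, AttainsBoundaryValues (W k) (G k) := fun k hk =>
      (attainsBoundaryValues_tri (c := fun z => 1 * conj z)
        (continuous_const.mul Complex.continuous_conj) hhb k).congr (fun _ _ => rfl)
        fun ζ _ => by
          have := tri_tri (1 * conj ζ) (-conj ζ) n (fun i => G i ζ) k
          rw [one_mul, add_neg_cancel, tri_zero hk] at this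
          simpa only [one_mul, holoData] using! this
    let U : ℕ → ℂ → ℂ := fun k z => Complex.exp (vekuaT a z) * W k z
    have hWc : ∀ k, ContinuousOn (W k) disk := fun k =>
      (continuousOn_tri (c := fun z => 1 * conj z)
        (continuous_const.mul Complex.continuous_conj) (fun l hl => (hhb l hl).1) k)
    have hUd : ∀ k, HasWeakDbar Complex.I (U k) (fun z => a z * U k z + U (k + 1) z) := fun k => by
      have h2 := (hWd k).exp_vekuaT_mul hq ha (hWc k)
      convert! h2 using 2 with z
      simp only [U]
      ring
    have hUit : ∀ k, IsVekuaIterate Complex.I a k f (U k) := fun k => by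
      induction k with
      | zero =>
        intro z hz
        rw [hf hz]
        simp only [U, W, hphi z hz, one_mul, h]
      | succ k ih => exact ⟨U k, ih, hUd k⟩
    have hUn : U n = fun _ => 0 := by
      ext z
      simp only [U, W, tri_of_le le_rfl, mul_zero]
    refine ⟨hUn ▸ hUit n, fun k hk => ⟨U k, hUit k, ?_⟩⟩
    refine ((hWb k hk).mul (m := fun z => Complex.exp (vekuaT a z)) (by fun_prop)).congr
      (fun _ _ => rfl) fun ζ _ => ?_
    simp only [hGdef]
    rw [mul_left_comm, ← Complex.exp_add, add_neg_cancel, Complex.exp_zero, mul_one]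

/-! ### The splitting of the bicomplex algebra into components -/

namespace Bicomplex

theorem plus_add (v w : Bicomplex) : plus (v + w) = plus v + plus w := by simp [plus]; ring

theorem minus_add (v w : Bicomplex) : minus (v + w) = minus v + minus w := by simp [minus]; ring

theorem plus_real_smul (r : ℝ) (w : Bicomplex) : plus (r • w) = r • plus w := by
  simp [plus]; ring

theorem minus_real_smul (r : ℝ) (w : Bicomplex) : minus (r • w) = r • minus w := by
  simp [minus]; ring

theorem plus_mul (v w : Bicomplex) : plus (v * w) = plus v * plus w := by
  simp [plus]
  linear_combination -(v.im * w.im) * Complex.I_mul_I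

theorem minus_mul (v w : Bicomplex) : minus (v * w) = minus v * minus w := by
  simp [minus]
  linear_combination -(v.im * w.im) * Complex.I_mul_I

theorem plus_j : plus j = -Complex.I := by simp [plus, j]

theorem minus_j : minus j = Complex.I := by simp [minus, j]

theorem ext_plus_minus {v w : Bicomplex} (h1 : plus v = plus w) (h2 : minus v = minus w) :
    v = w := by
  rw [plus_smul_add_minus_smul v, plus_smul_add_minus_smul w, h1, h2]

instance : FiniteDimensional ℝ Bicomplex :=
  FiniteDimensional.of_injective toProdL2 toProdL2_injective

/-- The real linear map `w ↦ (w⁺)*`. -/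
def plusConjCLM : Bicomplex →L[ℝ] ℂ :=
  LinearMap.toContinuousLinearMap
    { toFun := fun w => conj (plus w)
      map_add' := fun v w => by rw [plus_add, map_add]
      map_smul' := fun r w => by rw [plus_real_smul]; simp }

/-- The real linear map `w ↦ w⁻`. -/
def minusCLM : Bicomplex →L[ℝ] ℂ :=
  LinearMap.toContinuousLinearMap
    { toFun := minus
      map_add' := minus_add
      map_smul' := minus_real_smul }

/-- Multiplication by `j` as a real linear map. -/
def mulJCLM : Bicomplex →L[ℝ] Bicomplex :=
  LinearMap.toContinuousLinearMap
    { toFun := fun w => j * w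
      map_add' := mul_add j
      map_smul' := fun r w => by simp }

/-- The bicomplex number `w` with `(w⁺)* = p.1` and `w⁻ = p.2`, as a real linear map. -/
def ofComponents : ℂ × ℂ →L[ℝ] Bicomplex :=
  LinearMap.toContinuousLinearMap
    { toFun := fun p => conj p.1 • pPlus + p.2 • pMinus
      map_add' := fun p q => by simp only [Prod.fst_add, Prod.snd_add, map_add, add_smul]; abel
      map_smul' := fun r p => by
        refine ext_plus_minus ?_ ?_
        · rw [RingHom.id_apply, plus_real_smul, plus_combination, plus_combination]; simp
        · rw [RingHom.id_apply, minus_real_smul, minus_combination, minus_combination]; simp }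

theorem plusConjCLM_apply (w : Bicomplex) : plusConjCLM w = conj (plus w) := rfl

theorem plusConjCLM_ofComponents (p : ℂ × ℂ) : plusConjCLM (ofComponents p) = p.1 := by
  change conj (plus (conj p.1 • pPlus + p.2 • pMinus)) = _
  rw [plus_combination, Complex.conj_conj]

theorem minusCLM_ofComponents (p : ℂ × ℂ) : minusCLM (ofComponents p) = p.2 :=
  minus_combination _ _

theorem eq_iff_components {v w : Bicomplex} :
    v = w ↔ plusConjCLM v = plusConjCLM w ∧ minusCLM v = minusCLM w := by
  constructor
  · rintro rfl; exact ⟨rfl, rfl⟩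
  · rintro ⟨h1, h2⟩
    exact ext_plus_minus ((starRingEnd ℂ).injective h1) h2

theorem ofComponents_components (w : Bicomplex) :
    ofComponents (plusConjCLM w, minusCLM w) = w :=
  eq_iff_components.2 ⟨plusConjCLM_ofComponents _, minusCLM_ofComponents _⟩

theorem plusConjCLM_mul (v w : Bicomplex) :
    plusConjCLM (v * w) = plusConjCLM v * plusConjCLM w := by
  simp only [plusConjCLM_apply, plus_mul, map_mul]

theorem minusCLM_mul (v w : Bicomplex) : minusCLM (v * w) = minusCLM v * minusCLM w :=
  minus_mul v w

/-- Since `j⁺ = -i`, the conjugation is what makes both components satisfy equations with the same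
operator `∂/∂z*`. -/
theorem plusConjCLM_j : plusConjCLM j = Complex.I := by
  rw [plusConjCLM_apply, plus_j, map_neg, Complex.conj_I, neg_neg]

theorem minusCLM_j : minusCLM j = Complex.I := minus_j

end Bicomplex

open Bicomplex

section Transfer

variable {E F : Type} [NormedAddCommGroup E] [NormedSpace ℝ E] [NormedAddCommGroup F]
  [NormedSpace ℝ F]

theorem LocallyIntegrableOn.clm_comp {u : ℂ → E} (hu : LocallyIntegrableOn u disk)
    (L : E →L[ℝ] F) : LocallyIntegrableOn (fun z => L (u z)) disk := by
  rw [locallyIntegrableOn_iff isOpen_disk.isLocallyClosed] at hu ⊢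
  exact fun K hK hKc => L.integrable_comp (hu K hK hKc)

theorem integrableOn_smul_of_tsupport_subset {ψ : ℂ → ℝ} {u : ℂ → E} (hψ : Continuous ψ)
    (hc : HasCompactSupport ψ) (hs : tsupport ψ ⊆ disk) (hu : LocallyIntegrableOn u disk) :
    IntegrableOn (fun z => ψ z • u z) disk := by
  have h1 : IntegrableOn (fun z => ψ z • u z) (tsupport ψ) :=
    (hu.integrableOn_compact_subset hs hc).continuousOn_smul hψ.continuousOn hc
  refine h1.of_forall_sdiff_eq_zero measurableSet_disk fun z hz => ?_
  rw [image_eq_zero_of_notMem_tsupport hz.2, zero_smul]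

theorem IsTestFunction.integrableOn_smul {φ : ℂ → ℝ} {u : ℂ → E} (hφ : IsTestFunction φ)
    (hu : LocallyIntegrableOn u disk) : IntegrableOn (fun z => φ z • u z) disk :=
  integrableOn_smul_of_tsupport_subset hφ.smooth.continuous hφ.compact hφ.support hu

theorem IsTestFunction.integrableOn_fderiv_smul {φ : ℂ → ℝ} {u : ℂ → E} (hφ : IsTestFunction φ)
    (hu : LocallyIntegrableOn u disk) (v : ℂ) :
    IntegrableOn (fun z => fderiv ℝ φ z v • u z) disk := by
  have hsub : tsupport (fun z => fderiv ℝ φ z v) ⊆ tsupport φ := by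
    refine closure_minimal (fun z hz => ?_) (isClosed_tsupport φ)
    refine support_fderiv_subset ℝ fun h => hz ?_
    change fderiv ℝ φ z v = 0
    rw [h]; rfl
  refine integrableOn_smul_of_tsupport_subset
    ((hφ.smooth.continuous_fderiv (by simp)).clm_apply continuous_const)
    (hφ.compact.of_isClosed_subset (isClosed_tsupport _) hsub) (hsub.trans hφ.support) hu

end Transfer

theorem plusConj_eq (w : ℂ → Bicomplex) : plusConj w = fun z => plusConjCLM (w z) := rfl

theorem minusPart_eq (w : ℂ → Bicomplex) : minusPart w = fun z => minusCLM (w z) := rfl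

theorem plusConj_ofComponents (f g : ℂ → ℂ) :
    plusConj (fun z => ofComponents (f z, g z)) = f :=
  funext fun _ => plusConjCLM_ofComponents _

theorem minusPart_ofComponents (f g : ℂ → ℂ) :
    minusPart (fun z => ofComponents (f z, g z)) = g :=
  funext fun _ => minusCLM_ofComponents _

/-! ### Transfer of the weak problem to components -/

theorem locallyIntegrableOn_iff_components {u : ℂ → Bicomplex} :
    LocallyIntegrableOn u disk ↔
      LocallyIntegrableOn (plusConj u) disk ∧ LocallyIntegrableOn (minusPart u) disk := by
  constructor
  · intro h
    exact ⟨LocallyIntegrableOn.clm_comp h plusConjCLM, LocallyIntegrableOn.clm_comp h minusCLM⟩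
  · rintro ⟨h1, h2⟩
    have e : u = fun z => ofComponents (ContinuousLinearMap.inl ℝ ℂ ℂ (plusConj u z))
        + ofComponents (ContinuousLinearMap.inr ℝ ℂ ℂ (minusPart u z)) := by
      ext1 z
      rw [← map_add]
      simpa using! (ofComponents_components (u z)).symm
    rw [e]
    exact (LocallyIntegrableOn.clm_comp h1 (ofComponents.comp (ContinuousLinearMap.inl ℝ ℂ ℂ))).add
      (LocallyIntegrableOn.clm_comp h2 (ofComponents.comp (ContinuousLinearMap.inr ℝ ℂ ℂ)))

/-- A continuous real linear `L` commutes with the integrals and with the real test functions, and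
both components satisfy `L (j w) = i L w`. Together they separate points, which gives the converse.
-/
theorem hasWeakDbar_iff_components {u f : ℂ → Bicomplex} :
    HasWeakDbar j u f ↔ HasWeakDbar Complex.I (plusConj u) (plusConj f) ∧
      HasWeakDbar Complex.I (minusPart u) (minusPart f) := by
  have key : LocallyIntegrableOn u disk → LocallyIntegrableOn f disk → ∀ φ, IsTestFunction φ →
      ∀ L : Bicomplex →L[ℝ] ℂ, (∀ w, L (j * w) = Complex.I * L w) →
      L (∫ z in disk, (1 / 2 : ℝ) • ((fderiv ℝ φ z 1) • u z
          + (fderiv ℝ φ z Complex.I) • (j * u z)))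
        = ∫ z in disk, (1 / 2 : ℝ) • ((fderiv ℝ φ z 1) • L (u z)
          + (fderiv ℝ φ z Complex.I) • (Complex.I * L (u z))) ∧
      L (- ∫ z in disk, φ z • f z) = - ∫ z in disk, φ z • L (f z) := by
    intro hu hf φ hφ L hL
    have hju : LocallyIntegrableOn (fun z => j * u z) disk :=
      LocallyIntegrableOn.clm_comp hu mulJCLM
    have i1 := ((hφ.integrableOn_fderiv_smul hu 1).add
      (hφ.integrableOn_fderiv_smul hju Complex.I)).smul (1 / 2 : ℝ)
    have i2 := hφ.integrableOn_smul hf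
    constructor
    · refine (L.integral_comp_comm i1).symm.trans ?_
      congr 1 with z
      simp only [Pi.smul_apply, Pi.add_apply, map_smul, map_add, hL]
    · rw [map_neg, ← L.integral_comp_comm i2]
      simp only [map_smul]
  have hp : ∀ w, plusConjCLM (j * w) = Complex.I * plusConjCLM w := fun w => by
    rw [plusConjCLM_mul, plusConjCLM_j]
  have hm : ∀ w, minusCLM (j * w) = Complex.I * minusCLM w := fun w => by
    rw [minusCLM_mul, minusCLM_j]
  constructor
  · rintro ⟨hu, hf, h⟩
    obtain ⟨hu1, hu2⟩ := locallyIntegrableOn_iff_components.1 hu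
    obtain ⟨hf1, hf2⟩ := locallyIntegrableOn_iff_components.1 hf
    refine ⟨⟨hu1, hf1, fun φ hφ => ?_⟩, ⟨hu2, hf2, fun φ hφ => ?_⟩⟩
    · obtain ⟨e1, e2⟩ := key hu hf φ hφ plusConjCLM hp
      exact e1.symm.trans ((congrArg plusConjCLM (h φ hφ)).trans e2)
    · obtain ⟨e1, e2⟩ := key hu hf φ hφ minusCLM hm
      exact e1.symm.trans ((congrArg minusCLM (h φ hφ)).trans e2)
  · rintro ⟨⟨hu1, hf1, h1⟩, ⟨hu2, hf2, h2⟩⟩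
    have hu := locallyIntegrableOn_iff_components.2 ⟨hu1, hu2⟩
    have hf := locallyIntegrableOn_iff_components.2 ⟨hf1, hf2⟩
    refine ⟨hu, hf, fun φ hφ => eq_iff_components.2 ⟨?_, ?_⟩⟩
    · obtain ⟨e1, e2⟩ := key hu hf φ hφ plusConjCLM hp
      exact e1.trans ((h1 φ hφ).trans e2.symm)
    · obtain ⟨e1, e2⟩ := key hu hf φ hφ minusCLM hm
      exact e1.trans ((h2 φ hφ).trans e2.symm)

theorem eqOn_iff_components {v w : ℂ → Bicomplex} {s : Set ℂ} :
    EqOn v w s ↔ EqOn (plusConj v) (plusConj w) s ∧ EqOn (minusPart v) (minusPart w) s := by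
  constructor
  · intro h
    exact ⟨fun z hz => congrArg plusConjCLM (h hz), fun z hz => congrArg minusCLM (h hz)⟩
  · rintro ⟨h1, h2⟩ z hz
    exact eq_iff_components.2 ⟨h1 hz, h2 hz⟩

theorem plusConj_mul_add (A u v : ℂ → Bicomplex) :
    plusConj (fun z => A z * u z + v z) = fun z => plusConj A z * plusConj u z + plusConj v z := by
  ext z
  simp only [plusConj_eq, map_add, plusConjCLM_mul]

theorem minusPart_mul_add (A u v : ℂ → Bicomplex) :
    minusPart (fun z => A z * u z + v z)
      = fun z => minusPart A z * minusPart u z + minusPart v z := by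
  ext z
  simp only [minusPart_eq, map_add, minusCLM_mul]

/-- Both components are multiplicative, so the term `A u` splits too. In the converse the two
intermediate functions are unrelated, and `ofComponents` joins them into one bicomplex witness. -/
theorem isVekuaIterate_iff_components {A w : ℂ → Bicomplex} {k : ℕ} {v : ℂ → Bicomplex} :
    IsVekuaIterate j A k w v ↔
      IsVekuaIterate Complex.I (plusConj A) k (plusConj w) (plusConj v) ∧
        IsVekuaIterate Complex.I (minusPart A) k (minusPart w) (minusPart v) := by
  induction k generalizing v with
  | zero => exact eqOn_iff_components
  | succ k ih =>
    constructor
    · rintro ⟨u, hu, hd⟩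
      obtain ⟨h1, h2⟩ := ih.1 hu
      obtain ⟨d1, d2⟩ := hasWeakDbar_iff_components.1 hd
      rw [plusConj_mul_add] at d1
      rw [minusPart_mul_add] at d2
      exact ⟨⟨_, h1, d1⟩, ⟨_, h2, d2⟩⟩
    · rintro ⟨⟨u₁, h1, d1⟩, ⟨u₂, h2, d2⟩⟩
      refine ⟨fun z => ofComponents (u₁ z, u₂ z), ih.2 ?_, hasWeakDbar_iff_components.2 ?_⟩
      · rw [plusConj_ofComponents, minusPart_ofComponents]
        exact ⟨h1, h2⟩
      · rw [plusConj_mul_add, minusPart_mul_add, plusConj_ofComponents, minusPart_ofComponents]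
        exact ⟨d1, d2⟩

theorem attainsBoundaryValues_iff_components {v g : ℂ → Bicomplex} :
    AttainsBoundaryValues v g ↔ AttainsBoundaryValues (plusConj v) (plusConj g) ∧
      AttainsBoundaryValues (minusPart v) (minusPart g) := by
  constructor
  · rintro ⟨hc, hl⟩
    exact ⟨⟨plusConjCLM.continuous.comp_continuousOn hc,
        fun ζ hζ => (plusConjCLM.continuous.tendsto _).comp (hl ζ hζ)⟩,
      ⟨minusCLM.continuous.comp_continuousOn hc,
        fun ζ hζ => (minusCLM.continuous.tendsto _).comp (hl ζ hζ)⟩⟩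
  · rintro ⟨⟨hc1, hl1⟩, ⟨hc2, hl2⟩⟩
    have e : v = fun z => ofComponents (plusConj v z, minusPart v z) :=
      funext fun z => (ofComponents_components (v z)).symm
    refine ⟨?_, fun ζ hζ => ?_⟩
    · rw [e]
      exact ofComponents.continuous.comp_continuousOn (hc1.prodMk hc2)
    · rw [e, ← ofComponents_components (g ζ)]
      exact (ofComponents.continuous.tendsto _).comp ((hl1 ζ hζ).prodMk_nhds (hl2 ζ hζ))

theorem solvesDirichlet_iff_components {n : ℕ} {A : ℂ → Bicomplex} {γ : ℕ → ℂ → Bicomplex}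
    {w : ℂ → Bicomplex} :
    SolvesDirichlet j n A γ w ↔
      SolvesDirichlet Complex.I n (plusConj A) (fun k => plusConj (γ k)) (plusConj w) ∧
        SolvesDirichlet Complex.I n (minusPart A) (fun k => minusPart (γ k)) (minusPart w) := by
  have z1 : plusConj (fun _ => 0) = fun _ => 0 := funext fun _ => map_zero plusConjCLM
  have z2 : minusPart (fun _ => 0) = fun _ => 0 := funext fun _ => map_zero minusCLM
  unfold SolvesDirichlet
  rw [isVekuaIterate_iff_components, z1, z2]
  constructor
  · rintro ⟨⟨h1, h2⟩, hb⟩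
    refine ⟨⟨h1, fun k hk => ?_⟩, ⟨h2, fun k hk => ?_⟩⟩
    · obtain ⟨v, hv, hvb⟩ := hb k hk
      exact ⟨_, (isVekuaIterate_iff_components.1 hv).1,
        (attainsBoundaryValues_iff_components.1 hvb).1⟩
    · obtain ⟨v, hv, hvb⟩ := hb k hk
      exact ⟨_, (isVekuaIterate_iff_components.1 hv).2,
        (attainsBoundaryValues_iff_components.1 hvb).2⟩
  · rintro ⟨⟨h1, hb1⟩, ⟨h2, hb2⟩⟩
    refine ⟨⟨h1, h2⟩, fun k hk => ?_⟩
    obtain ⟨v₁, hv1, hvb1⟩ := hb1 k hk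
    obtain ⟨v₂, hv2, hvb2⟩ := hb2 k hk
    refine ⟨fun z => ofComponents (v₁ z, v₂ z), isVekuaIterate_iff_components.2 ?_,
      attainsBoundaryValues_iff_components.2 ?_⟩
    · rw [plusConj_ofComponents, minusPart_ofComponents]
      exact ⟨hv1, hv2⟩
    · rw [plusConj_ofComponents, minusPart_ofComponents]
      exact ⟨hvb1, hvb2⟩

theorem MemSobolev.memLp {E : Type} [NormedAddCommGroup E] [NormedSpace ℝ E] {p : ENNReal} {m : ℕ}
    {u : ℂ → E} (h : MemSobolev p m u) : MemLp u p (volume.restrict disk) := by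
  cases m with
  | zero => exact h
  | succ m => exact h.1

theorem plusConj_solutionFormula (n : ℕ) (A : ℂ → Bicomplex) (γ : ℕ → ℂ → Bicomplex) :
    plusConj (solutionFormula n A γ) = fun z => Complex.exp (vekuaT (plusConj A) z) *
      cauchyPhi n (plusConj A) (fun k => plusConj (γ k)) z := by
  ext z
  rw [plusConj, solutionFormula, plus_combination, Complex.conj_conj]

theorem minusPart_solutionFormula (n : ℕ) (A : ℂ → Bicomplex) (γ : ℕ → ℂ → Bicomplex) :
    minusPart (solutionFormula n A γ) = fun z => Complex.exp (vekuaT (minusPart A) z) *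
      cauchyPhi n (minusPart A) (fun k => minusPart (γ k)) z := by
  ext z
  rw [minusPart, solutionFormula, minus_combination]

end

/-! ### The main theorem -/

theorem mainTheorem5 (n : ℕ) (hn : 0 < n) (q : ℝ) (hq : 2 < q)
    (A : ℂ → Bicomplex) (hA : MemSobolev (ENNReal.ofReal q) (n - 1) A)
    (γ : ℕ → ℂ → Bicomplex)
    (hγ : ∀ k < n, ContinuousOn (γ k) (Metric.sphere (0 : ℂ) 1)) :
    (∀ w : ℂ → Bicomplex, List.TFAE
      [SolvesDirichlet Bicomplex.j n A γ w,
       SolvesDirichlet Complex.I n (plusConj A) (fun k => plusConj (γ k)) (plusConj w) ∧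
         SolvesDirichlet Complex.I n (minusPart A) (fun k => minusPart (γ k)) (minusPart w),
       CauchyConditions n (plusConj A) (fun k => plusConj (γ k)) ∧
         CauchyConditions n (minusPart A) (fun k => minusPart (γ k)) ∧
         EqOn w (solutionFormula n A γ) disk]) ∧
    List.TFAE
      [∃ w : ℂ → Bicomplex, SolvesDirichlet Bicomplex.j n A γ w,
       (∃ f : ℂ → ℂ, SolvesDirichlet Complex.I n (plusConj A) (fun k => plusConj (γ k)) f) ∧
         ∃ g : ℂ → ℂ, SolvesDirichlet Complex.I n (minusPart A) (fun k => minusPart (γ k)) g,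
       CauchyConditions n (plusConj A) (fun k => plusConj (γ k)) ∧
         CauchyConditions n (minusPart A) (fun k => minusPart (γ k))] := by
  have hS1 := solvesDirichlet_iff hn hq (Bicomplex.plusConjCLM.comp_memLp' hA.memLp)
    (g := fun k => plusConj (γ k)) fun k hk =>
      Bicomplex.plusConjCLM.continuous.comp_continuousOn (hγ k hk)
  have hS2 := solvesDirichlet_iff hn hq (Bicomplex.minusCLM.comp_memLp' hA.memLp)
    (g := fun k => minusPart (γ k)) fun k hk =>
      Bicomplex.minusCLM.continuous.comp_continuousOn (hγ k hk)
  change ∀ f, SolvesDirichlet Complex.I n (plusConj A) _ f ↔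
    CauchyConditions n (plusConj A) _ ∧ _ at hS1
  change ∀ f, SolvesDirichlet Complex.I n (minusPart A) _ f ↔
    CauchyConditions n (minusPart A) _ ∧ _ at hS2
  refine ⟨fun w => ?_, ?_⟩
  · tfae_have 1 ↔ 2 := solvesDirichlet_iff_components
    tfae_have 2 ↔ 3 := by
      rw [hS1, hS2, eqOn_iff_components, plusConj_solutionFormula, minusPart_solutionFormula]
      constructor
      · rintro ⟨⟨h1, h2⟩, h3, h4⟩
        exact ⟨h1, h3, h2, h4⟩
      · rintro ⟨h1, h3, h2, h4⟩
        exact ⟨⟨h1, h2⟩, h3, h4⟩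
    tfae_finish
  · tfae_have 1 → 2 := by
      rintro ⟨w, hw⟩
      obtain ⟨h1, h2⟩ := solvesDirichlet_iff_components.1 hw
      exact ⟨⟨_, h1⟩, ⟨_, h2⟩⟩
    tfae_have 2 → 3 := by
      rintro ⟨⟨f, hf⟩, ⟨g, hg⟩⟩
      exact ⟨((hS1 f).1 hf).1, ((hS2 g).1 hg).1⟩
    tfae_have 3 → 1 := by
      rintro ⟨h1, h2⟩
      -- Under the integral conditions the explicit formula is itself a solution, because its
      -- components are the two scalar formulas.
      refine ⟨solutionFormula n A γ, solvesDirichlet_iff_components.2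
        ⟨(hS1 _).2 ⟨h1, ?_⟩, (hS2 _).2 ⟨h2, ?_⟩⟩⟩
      · rw [plusConj_solutionFormula]; exact fun _ _ => rfl
      · rw [minusPart_solutionFormula]; exact fun _ _ => rfl
    tfae_finish
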